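/- Let $d\in\{2,3\}$ and let $\Omega\subset\mathbb R^d$ be a bounded domain with polyhedral Lipschitz boundary, subdivided by the interface $\Sigma=\partial\Omega_{\mathrm S}\cap\partial\Omega_{\mathrm D}$ into two disjoint subdomains $\Omega_{\mathrm S},\Omega_{\mathrm D}$, also bounded domains with polyhedral Lipschitz boundary, so that $\Omega=\Omega_{\mathrm S}\cup\Omega_{\mathrm D}\cup(\Omega\cap\Sigma)$. Put $\Gamma_\circ=\partial\Omega_\circ\setminus\Sigma$ for $\circ\in\{\mathrm S,\mathrm D\}$, and let $\boldsymbol\nu$ be the unit normal on $\Sigma$ pointing from $\Omega_{\mathrm S}$ to $\Omega_{\mathrm D}$. Let $$\mathbf H^1_{\mathrm S}(\Omega_{\mathrm S})=\{\mathbf u\in H^1(\Omega_{\mathrm S})^d:\mathbf u=\mathbf 0\text{ on }\Gamma_{\mathrm S}\},\qquad \mathbf H_{\mathrm D}(\mathrm{div},\Omega_{\mathrm D})=\{\mathbf u\in\mathbf H(\mathrm{div},\Omega_{\mathrm D}):\mathbf u\cdot\boldsymbol\nu=0\text{ on }\Gamma_{\mathrm D}\},$$ $$\mathbb X=\{(\mathbf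 u_{\mathrm S},\mathbf u_{\mathrm D})\in\mathbf H^1_{\mathrm S}(\Omega_{\mathrm S})\times\mathbf H_{\mathrm D}(\mathrm{div},\Omega_{\mathrm D}):\mathbf u_{\mathrm S}\cdot\boldsymbol\nu=\mathbf u_{\mathrm D}\cdot\boldsymbol\nu\text{ on }\Sigma\}.$$ For each $h$ in a set $\mathcal H\subset(0,\infty)$ let $\mathcal T^h_{\mathrm S},\mathcal T^h_{\mathrm D}$ be conforming triangulations of $\overline\Omega_{\mathrm S},\overline\Omega_{\mathrm D}$ into finitely many triangles ($d=2$) or tetrahedra ($d=3$) of diameter at most $h$, and let $\mathbf H^h(\Omega_{\mathrm S})\subset H^1(\Omega_{\mathrm S})^d$ and $\mathbf H^h(\Omega_{\mathrm D})\subset\mathbf H(\mathrm{div},\Omega_{\mathrm D})$ be finite-dimensional spaces of piecewise polynomial fields on these triangulations. Put $\mathbf H^h_{\mathrm S}(\Omega_{\mathrm S})=\mathbf H^h(\Omega_{\mathrm S})\cap\mathbf H^1_{\mathrm S}(\Omega_{\mathrm S})$, $\mathbf H^h_{\mathrm D}(\Omega_{\mathrm D})=\mathbf H^h(\Omega_{\mathrm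 D})\cap\mathbf H_{\mathrm D}(\mathrm{div},\Omega_{\mathrm D})$ and $\Phi^h_{\mathrm D}=\{\mathbf u_h\cdot\boldsymbol\nu|_\Sigma:\mathbf u_h\in\mathbf H^h_{\mathrm D}(\Omega_{\mathrm D})\}\subset L^2(\Sigma)$, and assume that $\Phi^h_{\mathrm D}$ contains the functions that are constant on each face of the partition of $\Sigma$ inherited from $\mathcal T^h_{\mathrm D}$. Assume that 1. there is a stable lifting of the normal trace: there are $C>0$, independent of $h$, and linear maps $\mathbf L^h:\Phi^h_{\mathrm D}\to\mathbf H^h_{\mathrm D}(\Omega_{\mathrm D})$, $h\in\mathcal H$, with $(\mathbf L^h\phi)\cdot\boldsymbol\nu=\phi$ on $\Sigma$ and $\|\mathbf L^h\phi\|_{\mathbf H(\mathrm{div},\Omega_{\mathrm D})}\le C\|\phi\|_{H^{-1/2}_{00}(\Sigma)}$ for all $\phi\in\Phi^h_{\mathrm D}$, where $H^{-1/2}_{00}(\Sigma)$ is the dual, with pivot space $L^2(\Sigma)$, of the space $H^{1/2}_{00}(\Sigma)$ of functions on $\Sigma$ whose extension by zero to $\partial\Omega_{\mathrm D}$ belongs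 to $H^{1/2}(\partial\Omega_{\mathrm D})$; 2. for every $(\mathbf u_{\mathrm S},\mathbf u_{\mathrm D})\in\mathbb X$, the sum of the separate best approximation errors $$\omega(h)=\inf_{\mathbf u^h_{\mathrm S}\in\mathbf H^h_{\mathrm S}(\Omega_{\mathrm S})}\|\mathbf u_{\mathrm S}-\mathbf u^h_{\mathrm S}\|_{\mathbf H^1(\Omega_{\mathrm S})}+\inf_{\mathbf u^h_{\mathrm D}\in\mathbf H^h_{\mathrm D}(\Omega_{\mathrm D})}\|\mathbf u_{\mathrm D}-\mathbf u^h_{\mathrm D}\|_{\mathbf H(\mathrm{div},\Omega_{\mathrm D})}$$ tends to zero as $h\to0$ in $\mathcal H$. Then there exist $h_0>0$ and constants $\beta_0,\beta_1>0$, independent of $h$, such that for every $h\in\mathcal H$ with $h\le h_0$ there is $\mathbf v_h\in\mathbf H^h_{\mathrm S}(\Omega_{\mathrm S})$ with $$\langle\mathbf v_h\cdot\boldsymbol\nu,1\rangle_\Sigma\ge\beta_0\qquad\text{and}\qquad\|\mathbf v_h\|_{\mathbf H^1(\Omega_{\mathrm S})}\le\beta_1 .$$ -/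

import Mathlib

open MeasureTheory Filter Topology Set Geometry
open scoped ENNReal ContDiff Gradient InnerProductSpace

noncomputable section

namespace StokesDarcy

/-- Euclidean space `ℝ^d`. -/
abbrev Pt (d : ℕ) : Type := EuclideanSpace ℝ (Fin d)

variable {d : ℕ}

/-! ### Geometry -/

/-- Near each boundary point, `O` is one side of the graph of a Lipschitz function. The function of
the `d - 1` variables orthogonal to the unit vector `e` is written as a Lipschitz function `g` on the
whole space that is constant in the direction `e`. -/
def HasLipschitzBoundary (O : Set (Pt d)) : Prop :=
  ∀ x ∈ frontier O, ∃ (e : Pt d) (g : Pt d → ℝ) (K : NNReal) (r : ℝ),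
    ‖e‖ = 1 ∧ LipschitzWith K g ∧ (∀ (y : Pt d) (t : ℝ), g (y + t • e) = g y) ∧ 0 < r ∧
      ∀ y ∈ Metric.ball x r, y ∈ O ↔ g y < ⟪e, y⟫_ℝ

/-- The boundary lies in a finite union of hyperplanes. -/
def HasPolyhedralBoundary (O : Set (Pt d)) : Prop :=
  ∃ F : Finset (Pt d × ℝ), (∀ p ∈ F, p.1 ≠ 0) ∧
    ∀ x ∈ frontier O, ∃ p ∈ F, ⟪p.1, x⟫_ℝ = p.2

/-- Bounded domains (nonempty, open, connected) with polyhedral Lipschitz boundary. -/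
structure IsPolyhedralLipschitzDomain (O : Set (Pt d)) : Prop where
  isOpen : IsOpen O
  isConnected : IsConnected O
  isBounded : Bornology.IsBounded O
  lipschitz : HasLipschitzBoundary O
  polyhedral : HasPolyhedralBoundary O

/-- The interface `Σ` between the two subdomains. -/
def interface (ΩS ΩD : Set (Pt d)) : Set (Pt d) := frontier ΩS ∩ frontier ΩD

/-- `Ω` is subdivided by the interface into the Stokes domain `ΩS` and the Darcy domain `ΩD`. -/
structure IsStokesDarcyGeometry (Ω ΩS ΩD : Set (Pt d)) : Prop where
  domain : IsPolyhedralLipschitzDomain Ω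
  domain_S : IsPolyhedralLipschitzDomain ΩS
  domain_D : IsPolyhedralLipschitzDomain ΩD
  disjoint : Disjoint ΩS ΩD
  union_eq : ΩS ∪ ΩD ∪ (Ω ∩ interface ΩS ΩD) = Ω

/-- `(d-1)`-dimensional surface measure on `S`. -/
def surf (S : Set (Pt d)) : Measure (Pt d) := (μHE[d - 1] : Measure (Pt d)).restrict S

/-- `n` is the outward unit normal of `O` at the point `x` in the relative interior of a flat face
of the boundary. For polyhedral Lipschitz domains these are almost all boundary points. -/
def IsOutwardNormal (O : Set (Pt d)) (x n : Pt d) : Prop :=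
  ‖n‖ = 1 ∧ ∃ r > 0, ∀ y ∈ Metric.ball x r, y ∈ O ↔ ⟪n, y - x⟫_ℝ < 0

open Classical in
/-- The outward unit normal vector field (with value zero where the boundary is not flat). -/
def outwardNormal (O : Set (Pt d)) (x : Pt d) : Pt d :=
  if h : ∃ n, IsOutwardNormal O x n then h.choose else 0

/-! ### Sobolev spaces -/

/-- Test functions `C_c^∞(O)`. -/
def IsTestFunction (O : Set (Pt d)) (φ : Pt d → ℝ) : Prop :=
  ContDiff ℝ ∞ φ ∧ HasCompactSupport φ ∧ tsupport φ ⊆ O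

theorem IsTestFunction.memLp {O : Set (Pt d)} {φ : Pt d → ℝ} (h : IsTestFunction O φ)
    (μ : Measure (Pt d)) [IsFiniteMeasureOnCompacts μ] : MemLp φ 2 μ :=
  h.1.continuous.memLp_of_hasCompactSupport h.2.1

theorem IsTestFunction.memLp_gradient {O : Set (Pt d)} {φ : Pt d → ℝ} (h : IsTestFunction O φ)
    (μ : Measure (Pt d)) [IsFiniteMeasureOnCompacts μ] : MemLp (∇ φ) 2 μ := by
  have hc : Continuous (∇ φ) :=
    (InnerProductSpace.toDual ℝ (Pt d)).symm.continuous.comp (h.1.continuous_fderiv (by simp))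
  refine hc.memLp_of_hasCompactSupport ?_
  exact (h.2.1.fderiv (𝕜 := ℝ)).comp_left (g := (InnerProductSpace.toDual ℝ (Pt d)).symm) (map_zero _)

/-- `G` is the weak gradient of `u` in `O`. -/
def IsWeakGradient (O : Set (Pt d)) (u : Lp ℝ 2 (volume.restrict O))
    (G : Lp (Pt d) 2 (volume.restrict O)) : Prop :=
  ∀ φ, IsTestFunction O φ → ∫ x in O, u x • ∇ φ x = -∫ x in O, φ x • G x

/-- `f` is the weak divergence of `u` in `O`. -/
def IsWeakDivergence (O : Set (Pt d)) (u : Lp (Pt d) 2 (volume.restrict O))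
    (f : Lp ℝ 2 (volume.restrict O)) : Prop :=
  ∀ φ, IsTestFunction O φ → ∫ x in O, ⟪u x, ∇ φ x⟫_ℝ = -∫ x in O, f x * φ x

theorem integrable_smul_of_L2 {F : Type*} [NormedAddCommGroup F] [NormedSpace ℝ F]
    {μ : Measure (Pt d)} {f : Pt d → ℝ} {g : Pt d → F} (hf : MemLp f 2 μ) (hg : MemLp g 2 μ) :
    Integrable (fun x => f x • g x) μ :=
  memLp_one_iff_integrable.1 (hg.smul (r := 1) hf)

theorem integrable_inner_of_L2 {μ : Measure (Pt d)} {f g : Pt d → Pt d} (hf : MemLp f 2 μ)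
    (hg : MemLp g 2 μ) : Integrable (fun x => ⟪f x, g x⟫_ℝ) μ := by
  refine (hf.norm.integrable_mul hg.norm).mono (hf.1.inner hg.1) (Eventually.of_forall fun x => ?_)
  simpa using abs_real_inner_le_norm (f x) (g x)

theorem isWeakGradient_zero (O : Set (Pt d)) : IsWeakGradient O 0 0 := by
  intro φ hφ
  have h1 := Lp.coeFn_zero ℝ 2 (volume.restrict O)
  have h2 := Lp.coeFn_zero (Pt d) 2 (volume.restrict O)
  rw [integral_congr_ae (g := fun _ => (0 : Pt d)) (by
    filter_upwards [h1] with x hx; rw [hx, Pi.zero_apply, zero_smul]),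
    integral_congr_ae (f := fun x => φ x • _) (g := fun _ => (0 : Pt d)) (by
    filter_upwards [h2] with x hx; rw [hx, Pi.zero_apply, smul_zero])]
  simp

theorem IsWeakGradient.add {O : Set (Pt d)} {u v : Lp ℝ 2 (volume.restrict O)}
    {G G' : Lp (Pt d) 2 (volume.restrict O)} (hu : IsWeakGradient O u G)
    (hv : IsWeakGradient O v G') : IsWeakGradient O (u + v) (G + G') := by
  intro φ hφ
  have hg := hφ.memLp_gradient (volume.restrict O)
  have hm := hφ.memLp (volume.restrict O)
  rw [integral_congr_ae (g := fun x => u x • ∇ φ x + v x • ∇ φ x) (by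
    filter_upwards [Lp.coeFn_add u v] with x hx; rw [hx, Pi.add_apply, add_smul]),
    integral_congr_ae (f := fun x => φ x • _) (g := fun x => φ x • G x + φ x • G' x) (by
    filter_upwards [Lp.coeFn_add G G'] with x hx; rw [hx, Pi.add_apply, smul_add]),
    integral_add (integrable_smul_of_L2 (Lp.memLp u) hg) (integrable_smul_of_L2 (Lp.memLp v) hg),
    integral_add (integrable_smul_of_L2 hm (Lp.memLp G)) (integrable_smul_of_L2 hm (Lp.memLp G')),
    hu φ hφ, hv φ hφ, neg_add]

theorem IsWeakGradient.smul {O : Set (Pt d)} {u : Lp ℝ 2 (volume.restrict O)}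
    {G : Lp (Pt d) 2 (volume.restrict O)} (hu : IsWeakGradient O u G) (c : ℝ) :
    IsWeakGradient O (c • u) (c • G) := by
  intro φ hφ
  rw [integral_congr_ae (g := fun x => c • (u x • ∇ φ x)) (by
    filter_upwards [Lp.coeFn_smul c u] with x hx; rw [hx, Pi.smul_apply, smul_assoc]),
    integral_congr_ae (f := fun x => φ x • _) (g := fun x => c • (φ x • G x)) (by
    filter_upwards [Lp.coeFn_smul c G] with x hx; rw [hx, Pi.smul_apply, smul_comm]),
    integral_smul, integral_smul, hu φ hφ, smul_neg]

theorem isWeakDivergence_zero (O : Set (Pt d)) : IsWeakDivergence O 0 0 := by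
  intro φ hφ
  have h1 := Lp.coeFn_zero (Pt d) 2 (volume.restrict O)
  have h2 := Lp.coeFn_zero ℝ 2 (volume.restrict O)
  rw [integral_congr_ae (g := fun _ => (0 : ℝ)) (by
    filter_upwards [h1] with x hx; rw [hx, Pi.zero_apply, inner_zero_left]),
    integral_congr_ae (f := fun x => _ * φ x) (g := fun _ => (0 : ℝ)) (by
    filter_upwards [h2] with x hx; rw [hx, Pi.zero_apply, zero_mul])]
  simp

theorem IsWeakDivergence.add {O : Set (Pt d)} {u v : Lp (Pt d) 2 (volume.restrict O)}
    {f g : Lp ℝ 2 (volume.restrict O)} (hu : IsWeakDivergence O u f)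
    (hv : IsWeakDivergence O v g) : IsWeakDivergence O (u + v) (f + g) := by
  intro φ hφ
  have hg := hφ.memLp_gradient (volume.restrict O)
  have hm := hφ.memLp (volume.restrict O)
  rw [integral_congr_ae (g := fun x => ⟪u x, ∇ φ x⟫_ℝ + ⟪v x, ∇ φ x⟫_ℝ) (by
    filter_upwards [Lp.coeFn_add u v] with x hx; rw [hx, Pi.add_apply, inner_add_left]),
    integral_congr_ae (f := fun x => _ * φ x) (g := fun x => f x • φ x + g x • φ x) (by
    filter_upwards [Lp.coeFn_add f g] with x hx; rw [hx, Pi.add_apply, add_mul]; rfl),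
    integral_add (integrable_inner_of_L2 (Lp.memLp u) hg) (integrable_inner_of_L2 (Lp.memLp v) hg),
    integral_add (integrable_smul_of_L2 (Lp.memLp f) hm) (integrable_smul_of_L2 (Lp.memLp g) hm),
    hu φ hφ, hv φ hφ, neg_add]
  rfl

theorem IsWeakDivergence.smul {O : Set (Pt d)} {u : Lp (Pt d) 2 (volume.restrict O)}
    {f : Lp ℝ 2 (volume.restrict O)} (hu : IsWeakDivergence O u f) (c : ℝ) :
    IsWeakDivergence O (c • u) (c • f) := by
  intro φ hφ
  rw [integral_congr_ae (g := fun x => c * ⟪u x, ∇ φ x⟫_ℝ) (by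
    filter_upwards [Lp.coeFn_smul c u] with x hx; rw [hx, Pi.smul_apply, real_inner_smul_left]),
    integral_congr_ae (f := fun x => _ * φ x) (g := fun x => c * (f x * φ x)) (by
    filter_upwards [Lp.coeFn_smul c f] with x hx
    rw [hx, Pi.smul_apply, smul_eq_mul, mul_assoc]),
    integral_const_mul, integral_const_mul, hu φ hφ, mul_neg]

/-- The Sobolev space `H¹(O)`. A function `u` is stored as the pair `(u, ∇u)` in `L² × L²`, so that
the norm is `(‖u‖² + ‖∇u‖²)^{1/2}`. -/
def H1 (O : Set (Pt d)) :
    Submodule ℝ (WithLp 2 (Lp ℝ 2 (volume.restrict O) × Lp (Pt d) 2 (volume.restrict O))) where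
  carrier := {u | IsWeakGradient O u.fst u.snd}
  zero_mem' := isWeakGradient_zero O
  add_mem' hu hv := IsWeakGradient.add hu hv
  smul_mem' c _ hu := IsWeakGradient.smul hu c

/-- The space `H¹(O)^d` with the product norm. -/
abbrev H1Vec (O : Set (Pt d)) : Type := PiLp 2 (fun _ : Fin d => H1 O)

/-- The space `H(div, O)`. A field `u` is stored as the pair `(u, div u)` in `L² × L²`, so that the
norm is `(‖u‖² + ‖div u‖²)^{1/2}`. -/
def Hdiv (O : Set (Pt d)) :
    Submodule ℝ (WithLp 2 (Lp (Pt d) 2 (volume.restrict O) × Lp ℝ 2 (volume.restrict O))) where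
  carrier := {u | IsWeakDivergence O u.fst u.snd}
  zero_mem' := isWeakDivergence_zero O
  add_mem' hu hv := IsWeakDivergence.add hu hv
  smul_mem' c _ hu := IsWeakDivergence.smul hu c

/-! ### Traces -/

/-- `γ ∈ L²(∂O)` is the trace of `u ∈ H¹(O)`: the trace operator is the continuous extension of the
restriction to the boundary from functions that are smooth up to the boundary. -/
def IsTrace (O : Set (Pt d)) (u : H1 O) (γ : Lp ℝ 2 (surf (frontier O))) : Prop :=
  ∃ φ : ℕ → Pt d → ℝ, (∀ n, ContDiff ℝ ∞ (φ n)) ∧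
    Tendsto (fun n => eLpNorm (fun x => φ n x - u.1.fst x) 2 (volume.restrict O)) atTop (𝓝 0) ∧
    Tendsto (fun n => eLpNorm (fun x => ∇ (φ n) x - u.1.snd x) 2 (volume.restrict O))
      atTop (𝓝 0) ∧
    Tendsto (fun n => eLpNorm (fun x => φ n x - γ x) 2 (surf (frontier O))) atTop (𝓝 0)

/-- The trace of a vector field, componentwise. -/
def IsVecTrace (O : Set (Pt d)) (u : H1Vec O) (γ : Fin d → Lp ℝ 2 (surf (frontier O))) : Prop :=
  ∀ i, IsTrace O (u i) (γ i)

/-- The normal component `γ · ν` on `∂O`, with `ν` pointing out of `O`. -/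
def normalComponent (O : Set (Pt d)) (γ : Fin d → Lp ℝ 2 (surf (frontier O))) (x : Pt d) : ℝ :=
  ∑ i, γ i x * outwardNormal O x i

/-- The duality product `⟨u · n, w⟩_{∂O} = (u, ∇w)_O + (div u, w)_O` that defines the normal trace
on `∂O` of `u ∈ H(div, O)`, with `n` pointing out of `O`. -/
def normalPairing {O : Set (Pt d)} (u : Hdiv O) (w : H1 O) : ℝ :=
  ⟪u.1.fst, w.1.snd⟫_ℝ + ⟪u.1.snd, w.1.fst⟫_ℝ

theorem gradient_add' {f g : Pt d → ℝ} (hf : ContDiff ℝ ∞ f) (hg : ContDiff ℝ ∞ g) (x : Pt d) :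
    ∇ (fun y => f y + g y) x = ∇ f x + ∇ g x := by
  have h1 := (hf.differentiable (by simp)) x
  have h2 := (hg.differentiable (by simp)) x
  exact (h1.hasGradientAt.hasFDerivAt.add h2.hasGradientAt.hasFDerivAt |> fun h => by
    rw [← map_add] at h; exact (HasGradientAt.gradient h))

theorem gradient_smul' {f : Pt d → ℝ} (hf : ContDiff ℝ ∞ f) (c : ℝ) (x : Pt d) :
    ∇ (fun y => c * f y) x = c • ∇ f x := by
  have h1 := (hf.differentiable (by simp)) x
  have h := h1.hasGradientAt.hasFDerivAt.const_mul c
  refine HasGradientAt.gradient ?_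
  rw [hasGradientAt_iff_hasFDerivAt]
  simpa using h

theorem tendsto_eLpNorm_add {F : Type*} [NormedAddCommGroup F] {μ : Measure (Pt d)}
    {a b : ℕ → Pt d → F} {u v w : Pt d → F} (ha : ∀ n, Continuous (a n)) (hb : ∀ n, Continuous (b n))
    (hu : AEStronglyMeasurable u μ) (hv : AEStronglyMeasurable v μ) (hw : w =ᵐ[μ] u + v)
    [SecondCountableTopology F] [MeasurableSpace F] [BorelSpace F]
    (h1 : Tendsto (fun n => eLpNorm (fun x => a n x - u x) 2 μ) atTop (𝓝 0))
    (h2 : Tendsto (fun n => eLpNorm (fun x => b n x - v x) 2 μ) atTop (𝓝 0)) :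
    Tendsto (fun n => eLpNorm (fun x => (a n x + b n x) - w x) 2 μ) atTop (𝓝 0) := by
  have h := h1.add h2
  rw [add_zero] at h
  refine tendsto_of_tendsto_of_tendsto_of_le_of_le tendsto_const_nhds h (fun n => zero_le) ?_
  intro n
  calc eLpNorm (fun x => (a n x + b n x) - w x) 2 μ
      = eLpNorm ((fun x => a n x - u x) + fun x => b n x - v x) 2 μ := by
        refine eLpNorm_congr_ae ?_
        filter_upwards [hw] with x hx
        simp only [hx, Pi.add_apply]
        abel
    _ ≤ _ := eLpNorm_add_le ((ha n).aestronglyMeasurable.sub hu)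
        ((hb n).aestronglyMeasurable.sub hv) (by norm_num)

theorem tendsto_eLpNorm_smul {F : Type*} [NormedAddCommGroup F] [NormedSpace ℝ F]
    {μ : Measure (Pt d)} {a : ℕ → Pt d → F} {u w : Pt d → F} (c : ℝ) (hw : w =ᵐ[μ] c • u)
    (h1 : Tendsto (fun n => eLpNorm (fun x => a n x - u x) 2 μ) atTop (𝓝 0)) :
    Tendsto (fun n => eLpNorm (fun x => c • a n x - w x) 2 μ) atTop (𝓝 0) := by
  have h := ENNReal.Tendsto.const_mul (a := ‖c‖ₑ) h1 (Or.inr (by simp))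
  rw [mul_zero] at h
  refine h.congr fun n => ?_
  rw [← eLpNorm_const_smul]
  refine eLpNorm_congr_ae ?_
  filter_upwards [hw] with x hx
  simp [hx, smul_sub]

theorem continuous_gradient' {f : Pt d → ℝ} (hf : ContDiff ℝ ∞ f) : Continuous (∇ f) :=
  (InnerProductSpace.toDual ℝ (Pt d)).symm.continuous.comp (hf.continuous_fderiv (by simp))

theorem IsTrace.smul {O : Set (Pt d)} {u : H1 O} {γ : Lp ℝ 2 (surf (frontier O))}
    (h : IsTrace O u γ) (c : ℝ) : IsTrace O (c • u) (c • γ) := by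
  obtain ⟨φ, hφ, h1, h2, h3⟩ := h
  refine ⟨fun n x => c * φ n x, fun n => contDiff_const.mul (hφ n),
    tendsto_eLpNorm_smul c (Lp.coeFn_smul c u.1.fst) h1, ?_,
    tendsto_eLpNorm_smul c (Lp.coeFn_smul c γ) h3⟩
  simp only [gradient_smul' (hφ _)]
  exact tendsto_eLpNorm_smul c (Lp.coeFn_smul c u.1.snd) h2

theorem IsTrace.add {O : Set (Pt d)} {u v : H1 O} {γ δ : Lp ℝ 2 (surf (frontier O))}
    (h : IsTrace O u γ) (h' : IsTrace O v δ) : IsTrace O (u + v) (γ + δ) := by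
  obtain ⟨φ, hφ, h1, h2, h3⟩ := h
  obtain ⟨ψ, hψ, h1', h2', h3'⟩ := h'
  refine ⟨fun n x => φ n x + ψ n x, fun n => (hφ n).add (hψ n),
    tendsto_eLpNorm_add (fun n => (hφ n).continuous) (fun n => (hψ n).continuous)
      (Lp.aestronglyMeasurable _) (Lp.aestronglyMeasurable _)
      (Lp.coeFn_add u.1.fst v.1.fst) h1 h1', ?_,
    tendsto_eLpNorm_add (fun n => (hφ n).continuous) (fun n => (hψ n).continuous)
      (Lp.aestronglyMeasurable _) (Lp.aestronglyMeasurable _) (Lp.coeFn_add γ δ) h3 h3'⟩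
  simp only [gradient_add' (hφ _) (hψ _)]
  exact tendsto_eLpNorm_add (fun n => continuous_gradient' (hφ n))
    (fun n => continuous_gradient' (hψ n))
    (Lp.aestronglyMeasurable _) (Lp.aestronglyMeasurable _)
    (Lp.coeFn_add u.1.snd v.1.snd) h2 h2'

theorem IsTrace.zero (O : Set (Pt d)) : IsTrace O 0 0 := by
  refine ⟨fun _ _ => 0, fun _ => contDiff_const, ?_, ?_, ?_⟩
  · refine tendsto_const_nhds.congr fun n => ?_
    rw [eLpNorm_congr_ae (g := (0 : Pt d → ℝ)), eLpNorm_zero]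
    filter_upwards [Lp.coeFn_zero ℝ 2 (volume.restrict O)] with x hx
    exact (congrArg (0 - ·) hx).trans (sub_zero _)
  · refine tendsto_const_nhds.congr fun n => ?_
    rw [eLpNorm_congr_ae (g := (0 : Pt d → Pt d)), eLpNorm_zero]
    filter_upwards [Lp.coeFn_zero (Pt d) 2 (volume.restrict O)] with x hx
    have h0 : ∇ (fun _ : Pt d => (0 : ℝ)) x = 0 := gradient_fun_const ..
    exact (congrArg₂ (· - ·) h0 hx).trans (sub_zero _)
  · refine tendsto_const_nhds.congr fun n => ?_
    rw [eLpNorm_congr_ae (g := (0 : Pt d → ℝ)), eLpNorm_zero]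
    filter_upwards [Lp.coeFn_zero ℝ 2 (surf (frontier O))] with x hx
    exact (congrArg (0 - ·) hx).trans (sub_zero _)

/-- `γ = 0` almost everywhere on the part `S` of `∂O`. -/
def VanishesOn {O : Set (Pt d)} (γ : Lp ℝ 2 (surf (frontier O))) (S : Set (Pt d)) : Prop :=
  ∀ᵐ x ∂(surf (frontier O)), x ∈ S → γ x = 0

theorem VanishesOn.add {O S : Set (Pt d)} {γ δ : Lp ℝ 2 (surf (frontier O))}
    (h : VanishesOn γ S) (h' : VanishesOn δ S) : VanishesOn (γ + δ) S := by
  filter_upwards [h, h', Lp.coeFn_add γ δ] with x h1 h2 h3 hx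
  rw [h3, Pi.add_apply, h1 hx, h2 hx, add_zero]

theorem VanishesOn.smul {O S : Set (Pt d)} {γ : Lp ℝ 2 (surf (frontier O))}
    (h : VanishesOn γ S) (c : ℝ) : VanishesOn (c • γ) S := by
  filter_upwards [h, Lp.coeFn_smul c γ] with x h1 h3 hx
  rw [h3, Pi.smul_apply, h1 hx, smul_zero]

theorem VanishesOn.zero (O S : Set (Pt d)) :
    VanishesOn (0 : Lp ℝ 2 (surf (frontier O))) S := by
  filter_upwards [Lp.coeFn_zero ℝ 2 (surf (frontier O))] with x h3 hx
  rw [h3, Pi.zero_apply]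

/-! ### The spaces of the coupled problem

In each subdomain `∂Ω∘ \ Σ` is the exterior boundary `Γ∘`. The unit normal `ν` on `Σ` points from
`ΩS` to `ΩD`: it is the outward normal of `ΩS` and minus the outward normal of `ΩD`. -/

/-- `H¹_S(ΩS)`: fields in `H¹(ΩS)^d` whose trace vanishes on `ΓS`. -/
def H1S (ΩS ΩD : Set (Pt d)) : Submodule ℝ (H1Vec ΩS) where
  carrier := {u | ∃ γ, IsVecTrace ΩS u γ ∧ ∀ i, VanishesOn (γ i) (frontier ΩS \ interface ΩS ΩD)}
  zero_mem' := ⟨fun _ => 0, fun _ => IsTrace.zero ΩS, fun _ => VanishesOn.zero _ _⟩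
  add_mem' := by
    rintro u v ⟨γ, h1, h2⟩ ⟨δ, h3, h4⟩
    exact ⟨fun i => γ i + δ i, fun i => (h1 i).add (h3 i), fun i => (h2 i).add (h4 i)⟩
  smul_mem' := by
    rintro c u ⟨γ, h1, h2⟩
    exact ⟨fun i => c • γ i, fun i => (h1 i).smul c, fun i => (h2 i).smul c⟩

theorem normalPairing_add {O : Set (Pt d)} (u v : Hdiv O) (w : H1 O) :
    normalPairing (u + v) w = normalPairing u w + normalPairing v w := by
  simp only [normalPairing, Submodule.coe_add, WithLp.add_fst, WithLp.add_snd, inner_add_left]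
  ring

theorem normalPairing_smul {O : Set (Pt d)} (c : ℝ) (u : Hdiv O) (w : H1 O) :
    normalPairing (c • u) w = c * normalPairing u w := by
  simp only [normalPairing, Submodule.coe_smul, WithLp.smul_fst, WithLp.smul_snd,
    real_inner_smul_left]
  ring

/-- `H_D(div, ΩD)`: fields in `H(div, ΩD)` with `u · ν = 0` on `ΓD`, that is, whose normal trace is
annihilated by all traces that vanish on `Σ`. -/
def HD (ΩS ΩD : Set (Pt d)) : Submodule ℝ (Hdiv ΩD) where
  carrier := {u | ∀ w γ, IsTrace ΩD w γ → VanishesOn γ (interface ΩS ΩD) → normalPairing u w = 0}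
  zero_mem' := by
    intro w γ _ _
    simpa using normalPairing_smul 0 (0 : Hdiv ΩD) w
  add_mem' := by
    intro u v hu hv w γ h1 h2
    rw [normalPairing_add, hu w γ h1 h2, hv w γ h1 h2, add_zero]
  smul_mem' := by
    intro c u hu w γ h1 h2
    rw [normalPairing_smul, hu w γ h1 h2, mul_zero]

/-- `u · ν = φ` on `Σ` for `u ∈ H(div, ΩD)`: an identity of functionals on `H₀₀^{1/2}(Σ)`, the
traces that vanish on `ΓD`. -/
def HasNormalTrace (ΩS : Set (Pt d)) {ΩD : Set (Pt d)} (u : Hdiv ΩD) (φ : Pt d → ℝ) : Prop :=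
  ∀ w γ, IsTrace ΩD w γ → VanishesOn γ (frontier ΩD \ interface ΩS ΩD) →
    normalPairing u w = -∫ x, φ x * γ x ∂(surf (interface ΩS ΩD))

/-- The velocity space `𝕏`: pairs in `H¹_S(ΩS) × H_D(div, ΩD)` with `uS · ν = uD · ν` on `Σ`. -/
def VelocitySpace (ΩS ΩD : Set (Pt d)) : Set (H1Vec ΩS × Hdiv ΩD) :=
  {u | u.1 ∈ H1S ΩS ΩD ∧ u.2 ∈ HD ΩS ΩD ∧
    ∃ γ, IsVecTrace ΩS u.1 γ ∧ HasNormalTrace ΩS u.2 (normalComponent ΩS γ)}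

/-- The norm of `H^{1/2}(∂O)`, the image of the trace operator with its quotient norm. -/
def halfNorm {O : Set (Pt d)} (γ : Lp ℝ 2 (surf (frontier O))) : ℝ :=
  sInf {t | ∃ w : H1 O, IsTrace O w γ ∧ t = ‖w‖}

/-- `H₀₀^{1/2}(Σ)`. A function on `Σ` is identified with its extension by zero to `∂ΩD`. -/
def H00Half (ΩS ΩD : Set (Pt d)) : Set (Lp ℝ 2 (surf (frontier ΩD))) :=
  {γ | (∃ w, IsTrace ΩD w γ) ∧ VanishesOn γ (frontier ΩD \ interface ΩS ΩD)}

/-- The norm of `φ ∈ L²(Σ)` in `H₀₀^{-1/2}(Σ)`, the dual of `H₀₀^{1/2}(Σ)` with respect to the pivot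
space `L²(Σ)`. -/
def dualHalfNorm (ΩS ΩD : Set (Pt d)) (φ : Lp ℝ 2 (surf (interface ΩS ΩD))) : ℝ≥0∞ :=
  ⨆ γ ∈ {γ | γ ∈ H00Half ΩS ΩD ∧ halfNorm γ ≤ 1},
    ENNReal.ofReal |∫ x, φ x * γ x ∂(surf (interface ΩS ΩD))|

/-! ### Discrete spaces -/

/-- `K` is a conforming triangulation of the closure of `O` into finitely many triangles (`d = 2`) or
tetrahedra (`d = 3`) of diameter at most `h`. -/
structure IsTriangulation (O : Set (Pt d)) (h : ℝ) (K : SimplicialComplex ℝ (Pt d)) : Prop where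
  finite : K.faces.Finite
  space_eq : K.space = closure O
  pure : ∀ s ∈ K.faces, ∃ t ∈ K.faces, s ⊆ t ∧ t.card = d + 1
  diam_le : ∀ t ∈ K.faces, Metric.diam (convexHull ℝ (t : Set (Pt d))) ≤ h

/-- `f` agrees almost everywhere on each element of `K` with a polynomial. -/
def IsPiecewisePolynomial (K : SimplicialComplex ℝ (Pt d)) (μ : Measure (Pt d))
    (f : Pt d → ℝ) : Prop :=
  ∀ t ∈ K.faces, t.card = d + 1 → ∃ p : MvPolynomial (Fin d) ℝ,
    ∀ᵐ x ∂μ, x ∈ convexHull ℝ (t : Set (Pt d)) → f x = MvPolynomial.eval (fun i => x i) p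

/-- A finite dimensional space `H^h(ΩS) ⊆ H¹(ΩS)^d` of piecewise polynomial fields. -/
structure IsStokesSpace {ΩS : Set (Pt d)} (K : SimplicialComplex ℝ (Pt d))
    (V : Submodule ℝ (H1Vec ΩS)) : Prop where
  finiteDimensional : FiniteDimensional ℝ V
  piecewise : ∀ v ∈ V, ∀ i, IsPiecewisePolynomial K (volume.restrict ΩS) (v i).1.fst

/-- A finite dimensional space `H^h(ΩD) ⊆ H(div, ΩD)` of piecewise polynomial fields. -/
structure IsDarcySpace {ΩD : Set (Pt d)} (K : SimplicialComplex ℝ (Pt d))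
    (V : Submodule ℝ (Hdiv ΩD)) : Prop where
  finiteDimensional : FiniteDimensional ℝ V
  piecewise : ∀ v ∈ V, ∀ i, IsPiecewisePolynomial K (volume.restrict ΩD) (fun x => v.1.fst x i)

theorem integrable_mul_trace (ΩS : Set (Pt d)) {ΩD : Set (Pt d)}
    (φ : Lp ℝ 2 (surf (interface ΩS ΩD))) (γ : Lp ℝ 2 (surf (frontier ΩD))) :
    Integrable (fun x => φ x * γ x) (surf (interface ΩS ΩD)) :=
  (Lp.memLp φ).integrable_mul
    ((Lp.memLp γ).mono_measure (Measure.restrict_mono Set.inter_subset_right le_rfl))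

/-- `Φ_D^h`: the `L²(Σ)` normal components on `Σ` of the fields in `H^h_D(ΩD)`. -/
def PhiD (ΩS : Set (Pt d)) {ΩD : Set (Pt d)} (V : Submodule ℝ (Hdiv ΩD)) :
    Submodule ℝ (Lp ℝ 2 (surf (interface ΩS ΩD))) where
  carrier := {φ | ∃ u ∈ V ⊓ HD ΩS ΩD, HasNormalTrace ΩS u φ}
  zero_mem' := by
    refine ⟨0, zero_mem _, fun w γ _ _ => ?_⟩
    rw [integral_congr_ae (g := fun _ => (0 : ℝ)) (by
      filter_upwards [Lp.coeFn_zero ℝ 2 (surf (interface ΩS ΩD))] with x hx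
      rw [hx, Pi.zero_apply, zero_mul])]
    simpa using normalPairing_smul 0 (0 : Hdiv ΩD) w
  add_mem' := by
    rintro φ ψ ⟨u, hu, h1⟩ ⟨v, hv, h2⟩
    refine ⟨u + v, add_mem hu hv, fun w γ hw hγ => ?_⟩
    rw [integral_congr_ae (g := fun x => φ x * γ x + ψ x * γ x) (by
      filter_upwards [Lp.coeFn_add φ ψ] with x hx; rw [hx, Pi.add_apply, add_mul]),
      integral_add (integrable_mul_trace ΩS φ γ) (integrable_mul_trace ΩS ψ γ),
      normalPairing_add, h1 w γ hw hγ, h2 w γ hw hγ, neg_add]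
  smul_mem' := by
    rintro c φ ⟨u, hu, h1⟩
    refine ⟨c • u, Submodule.smul_mem _ c hu, fun w γ hw hγ => ?_⟩
    rw [integral_congr_ae (g := fun x => c * (φ x * γ x)) (by
      filter_upwards [Lp.coeFn_smul c φ] with x hx
      rw [hx, Pi.smul_apply, smul_eq_mul, mul_assoc]),
      integral_const_mul, normalPairing_smul, h1 w γ hw hγ, mul_neg]

/-- The piecewise constant functions on the partition of `Σ` inherited from `K`. -/
def piecewiseConstant (S : Set (Pt d)) (K : SimplicialComplex ℝ (Pt d)) : Set (Lp ℝ 2 (surf S)) :=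
  {φ | ∀ e ∈ K.faces, e.card = d → ∃ c : ℝ,
    ∀ᵐ x ∂(surf S), x ∈ convexHull ℝ (e : Set (Pt d)) → φ x = c}

/-- A stable lifting of the normal trace in the family `H^h(ΩD)`, `h ∈ H`: linear right inverses
`L^h : Φ_D^h → H^h_D(ΩD)` of the normal trace, bounded uniformly in `h` from the norm of
`H₀₀^{-1/2}(Σ)` to that of `H(div, ΩD)`. -/
def HasStableLifting (ΩS ΩD : Set (Pt d)) (H : Set ℝ) (VD : ℝ → Submodule ℝ (Hdiv ΩD)) : Prop :=
  ∃ C : ℝ, 0 < C ∧ ∀ h ∈ H, ∃ L : PhiD ΩS (VD h) →ₗ[ℝ] Hdiv ΩD, ∀ φ : PhiD ΩS (VD h),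
    L φ ∈ VD h ⊓ HD ΩS ΩD ∧ HasNormalTrace ΩS (L φ) φ.1 ∧
      ENNReal.ofReal ‖L φ‖ ≤ ENNReal.ofReal C * dualHalfNorm ΩS ΩD φ.1

/-- The sum `ω(h)` of the separate best approximation errors of `u = (uS, uD)` in `H^h_S(ΩS)` and
`H^h_D(ΩD)`. -/
def bestApproximationError {ΩS ΩD : Set (Pt d)} (VS : Submodule ℝ (H1Vec ΩS))
    (VD : Submodule ℝ (Hdiv ΩD)) (u : H1Vec ΩS × Hdiv ΩD) : ℝ :=
  (⨅ v : ↥(VS ⊓ H1S ΩS ΩD), ‖u.1 - v‖) + ⨅ v : ↥(VD ⊓ HD ΩS ΩD), ‖u.2 - v‖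

/-- There is a field `v ∈ H^h_S(ΩS)` with `⟨v · ν, 1⟩_Σ ≥ β₀` and `‖v‖_{H¹(ΩS)} ≤ β₁`. -/
def IsPermeable {ΩS : Set (Pt d)} (ΩD : Set (Pt d)) (VS : Submodule ℝ (H1Vec ΩS))
    (β₀ β₁ : ℝ) : Prop :=
  ∃ v ∈ VS ⊓ H1S ΩS ΩD, ∃ γ, IsVecTrace ΩS v γ ∧
    β₀ ≤ ∫ x, normalComponent ΩS γ x ∂(surf (interface ΩS ΩD)) ∧ ‖v‖ ≤ β₁

end StokesDarcy

end

open StokesDarcy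

noncomputable section

namespace StokesDarcy

variable {d : ℕ}

/-! ### Surface measure on hyperplanes -/

/-! One fixed velocity field with positive flux suffices. Suppose `u` in `VelocitySpace` has Stokes
component `u.1` with flux `I > 0` through the interface. By the approximation hypothesis, for small
`h` there is a discrete Stokes field `v` vanishing on the exterior boundary and as close to `u.1` in
`H¹` as desired. The flux is continuous in `H¹`, so that of `v` is at least `I / 2`, and the norm of
`v` exceeds that of `u.1` by at most a fixed amount.

Existence of `u` (`exists_positive_flux`). Since `Ω` is connected, the interface has a point inside
`Ω`. There the boundary of `ΩS` is a Lipschitz graph covered by finitely many hyperplanes, and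
Baire's theorem makes it coincide with one of them near some point (`exists_affine_point`), with
`ΩS` and `ΩD` on the two sides (`exists_flat`). With a bump `ψ` supported near that point and the
unit normal `n`, the fields `ψ n` in `ΩS` and `κ ψ n` in `ΩD` have the same normal trace `ψ` on the
interface. The positive factor `κ` comes from `exists_integral_halfSpace`, where Lebesgue measure is
compared with surface measure times length by uniqueness of Haar measure, so its value is never
computed.

Continuity of the flux (`exists_flux_bound`). The normal is bounded by one, so an `L¹` bound for
traces is enough. On each hyperplane carrying a piece of the boundary, the value of a smooth
function is bounded by an integral along a short segment entering the domain transversally.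
Integrating over the hyperplane gives the trace inequality
(`IsPolyhedralLipschitzDomain.hasTraceBound`), which passes to `H¹` because traces are defined as
limits of smooth functions. It holds for every admissible trace, so uniqueness of the trace is not
needed. -/

/-- The hyperplane `⟪n, y⟫ = c`. -/
def hyperplane (n : Pt d) (c : ℝ) : Set (Pt d) := {y | ⟪n, y⟫_ℝ = c}

theorem isClosed_hyperplane (n : Pt d) (c : ℝ) : IsClosed (hyperplane n c) :=
  isClosed_eq (by fun_prop) continuous_const

theorem finrank_orthogonal_span {n : Pt d} (hn : n ≠ 0) :
    Module.finrank ℝ ((ℝ ∙ n)ᗮ : Submodule ℝ (Pt d)) = d - 1 := by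
  have h := (ℝ ∙ n).finrank_add_finrank_orthogonal
  rw [finrank_span_singleton hn, finrank_euclideanSpace_fin] at h
  omega

/-- Isometries transport Hausdorff measure, and on the `(d - 1)`-dimensional Euclidean space `nᗮ`
the normalized Hausdorff measure is the volume. Translation by `p` maps `nᗮ` isometrically onto the
hyperplane. -/
theorem restrict_hyperplane {n p : Pt d} (hn : n ≠ 0) :
    (μHE[d - 1] : Measure (Pt d)).restrict (hyperplane n ⟪n, p⟫_ℝ) =
      (volume : Measure ((ℝ ∙ n)ᗮ : Submodule ℝ (Pt d))).map
        (fun w : ((ℝ ∙ n)ᗮ : Submodule ℝ (Pt d)) => p + (w : Pt d)) := by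
  have hf : Isometry (fun w : ((ℝ ∙ n)ᗮ : Submodule ℝ (Pt d)) => p + (w : Pt d)) :=
    (isometry_add_left p).comp isometry_subtype_coe
  rw [← InnerProductSpace.euclideanHausdorffMeasure_eq_volume, finrank_orthogonal_span hn,
    hf.map_euclideanHausdorffMeasure]
  congr 1
  ext y
  simp only [hyperplane, mem_ofPred_eq, mem_range]
  constructor
  · intro h
    refine ⟨⟨y - p, ?_⟩, by simp⟩
    rw [Submodule.mem_orthogonal_singleton_iff_inner_right, inner_sub_right, h, sub_self]
  · rintro ⟨w, rfl⟩
    rw [inner_add_right, Submodule.mem_orthogonal_singleton_iff_inner_right.1 w.2, add_zero]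

/-- The splitting of space along a hyperplane and a transversal direction. -/
def transversalEquiv (n e : Pt d) (h : ⟪n, e⟫_ℝ ≠ 0) :
    (((ℝ ∙ n)ᗮ : Submodule ℝ (Pt d)) × ℝ) ≃L[ℝ] Pt d :=
  (LinearEquiv.ofBijective
    ((Submodule.subtype _).coprod (LinearMap.toSpanSingleton ℝ (Pt d) e)) (by
      constructor
      · rw [← LinearMap.ker_eq_bot, LinearMap.ker_eq_bot']
        rintro ⟨w, t⟩ hw
        simp only [LinearMap.coprod_apply, Submodule.subtype_apply,
          LinearMap.toSpanSingleton_apply] at hw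
        have h2 := congrArg (fun y => ⟪n, y⟫_ℝ) hw
        simp only [inner_add_right, Submodule.mem_orthogonal_singleton_iff_inner_right.1 w.2,
          inner_smul_right, inner_zero_right, zero_add, mul_eq_zero, h, or_false] at h2
        subst h2
        simpa using hw
      · intro y
        refine ⟨⟨⟨y - (⟪n, y⟫_ℝ / ⟪n, e⟫_ℝ) • e, ?_⟩, ⟪n, y⟫_ℝ / ⟪n, e⟫_ℝ⟩, ?_⟩
        · rw [Submodule.mem_orthogonal_singleton_iff_inner_right, inner_sub_right,
            inner_smul_right]
          field_simp
          ring
        · simp)).toContinuousLinearEquiv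

theorem transversalEquiv_apply (n e : Pt d) (h : ⟪n, e⟫_ℝ ≠ 0) (q) :
    transversalEquiv n e h q = q.1 + q.2 • e := rfl

theorem exists_mem_hyperplane {n : Pt d} (hn : n ≠ 0) (c : ℝ) : ∃ p, ⟪n, p⟫_ℝ = c :=
  ⟨(c / ⟪n, n⟫_ℝ) • n, by
    rw [inner_smul_right, div_mul_cancel₀]; exact inner_self_ne_zero.2 hn⟩

/-- Needed for the product measure and the Tonelli and Fubini theorems over the hyperplane. -/
theorem sigmaFinite_restrict_hyperplane {n : Pt d} (hn : n ≠ 0) (c : ℝ) :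
    SigmaFinite ((μHE[d - 1] : Measure (Pt d)).restrict (hyperplane n c)) := by
  obtain ⟨p, rfl⟩ := exists_mem_hyperplane hn c
  rw [restrict_hyperplane hn]
  have h : MeasurableEmbedding (fun w : ((ℝ ∙ n)ᗮ : Submodule ℝ (Pt d)) => p + (w : Pt d)) :=
    (measurableEmbedding_addLeft p).comp
      (MeasurableEmbedding.subtype_coe (Submodule.closed_of_finiteDimensional _).measurableSet)
  exact h.sigmaFinite_map

/-- Integration over a hyperplane and along a transversal direction is a multiple of integration
over space. -/
theorem exists_map_prod_hyperplane {n e : Pt d} (h : ⟪n, e⟫_ℝ ≠ 0) (c : ℝ) :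
    ∃ κ : NNReal, κ ≠ 0 ∧
      (((μHE[d - 1] : Measure (Pt d)).restrict (hyperplane n c)).prod volume).map
        (fun q : Pt d × ℝ => q.1 + q.2 • e) = κ • (volume : Measure (Pt d)) := by
  have hn : n ≠ 0 := by rintro rfl; simp at h
  obtain ⟨p, rfl⟩ := exists_mem_hyperplane hn c
  -- A linear isomorphism carries the product measure to a Haar measure, hence to a multiple of
  -- Lebesgue measure; the factor `κ` needs no evaluation.
  have hH : (((volume : Measure ((ℝ ∙ n)ᗮ : Submodule ℝ (Pt d))).prod (volume : Measure ℝ)).map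
      (transversalEquiv n e h)).IsAddHaarMeasure :=
    (transversalEquiv n e h).isAddHaarMeasure_map _
  have hm : Measurable (fun w : ((ℝ ∙ n)ᗮ : Submodule ℝ (Pt d)) => p + (w : Pt d)) := by
    fun_prop
  have hprod := Measure.map_prod_map (volume : Measure ((ℝ ∙ n)ᗮ : Submodule ℝ (Pt d)))
    (volume : Measure ℝ) hm measurable_id
  rw [Measure.map_id] at hprod
  have hcomp : ((fun q : Pt d × ℝ => q.1 + q.2 • e) ∘ Prod.map
      (fun w : ((ℝ ∙ n)ᗮ : Submodule ℝ (Pt d)) => p + (w : Pt d)) id) =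
      (p + ·) ∘ transversalEquiv n e h := by
    ext1 q
    simp [transversalEquiv_apply, add_assoc]
  rw [restrict_hyperplane hn, hprod, Measure.map_map (by fun_prop) (hm.prodMap measurable_id),
    hcomp, ← Measure.map_map (by fun_prop) (transversalEquiv n e h).continuous.measurable,
    map_add_left_eq_self]
  exact ⟨_, (Measure.addHaarScalarFactor_pos_of_isAddHaarMeasure _ volume).ne',
    Measure.isAddLeftInvariant_eq_smul _ volume⟩

/-! ### Local structure of the boundary -/

/-- Inside a ball where `O` lies above the graph of `g`, the boundary of `O` is the graph. -/
theorem mem_frontier_iff_graph {O : Set (Pt d)} (hO : IsOpen O) {x e : Pt d} {g : Pt d → ℝ} {r : ℝ}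
    (hg : Continuous g) (he : ‖e‖ = 1) (hge : ∀ (y : Pt d) (t : ℝ), g (y + t • e) = g y)
    (h : ∀ y ∈ Metric.ball x r, y ∈ O ↔ g y < ⟪e, y⟫_ℝ) {y : Pt d} (hy : y ∈ Metric.ball x r) :
    y ∈ frontier O ↔ g y = ⟪e, y⟫_ℝ := by
  have hball : Metric.ball x r ∈ 𝓝 y := Metric.isOpen_ball.mem_nhds hy
  rw [frontier, hO.interior_eq, Set.mem_sdiff, h y hy, not_lt]
  constructor
  · rintro ⟨h1, h2⟩
    refine h2.antisymm' (not_lt.1 fun h3 => ?_)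
    have h4 : {z | ⟪e, z⟫_ℝ < g z} ∈ 𝓝 y :=
      (isOpen_lt (by fun_prop) hg).mem_nhds h3
    obtain ⟨z, ⟨hz1, hz2⟩, hz3⟩ := mem_closure_iff_nhds.1 h1 _ (inter_mem hball h4)
    exact absurd ((h z hz1).1 hz3) (not_lt.2 (le_of_lt hz2))
  · intro h1
    refine ⟨?_, h1.ge⟩
    -- Moving along `e` leaves `g` fixed and raises `⟪e, ·⟫`, so a point of the graph is a limit of
    -- points of `O`.
    have hc : Continuous fun t : ℝ => y + t • e := by fun_prop
    have h2 : Tendsto (fun t : ℝ => y + t • e) (𝓝[>] 0) (𝓝 y) := by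
      simpa using (hc.tendsto 0).mono_left nhdsWithin_le_nhds
    refine mem_closure_of_tendsto h2 ?_
    filter_upwards [h2 hball, self_mem_nhdsWithin] with t ht1 ht2
    rw [h _ ht1, hge, inner_add_right, inner_smul_right, real_inner_self_eq_norm_sq, he, h1]
    simpa using ht2

/-- A graph covered by finitely many hyperplanes is flat near some point. -/
theorem exists_affine_point {e : Pt d} {g : Pt d → ℝ} (hg : Continuous g) (he : ‖e‖ = 1)
    (hge : ∀ (y : Pt d) (t : ℝ), g (y + t • e) = g y) {W : Set (Pt d)} (hW : IsOpen W)
    {F : Finset (Pt d × ℝ)} (hF0 : ∀ q ∈ F, q.1 ≠ 0)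
    (hF : ∀ y ∈ W, g y = ⟪e, y⟫_ℝ → ∃ q ∈ F, ⟪q.1, y⟫_ℝ = q.2)
    {x₀ : Pt d} (hx₀ : x₀ ∈ W) (hgx₀ : g x₀ = ⟪e, x₀⟫_ℝ) :
    ∃ (x w : Pt d) (ρ : ℝ), w ≠ 0 ∧ 0 < ρ ∧
      ∀ y ∈ Metric.ball x ρ, y ∈ W ∧ g y - ⟪e, y⟫_ℝ = ⟪w, y - x⟫_ℝ := by
  have hee : ⟪e, e⟫_ℝ = 1 := by rw [real_inner_self_eq_norm_sq, he]; norm_num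
  -- `p` is the projection onto the graph along `e`.
  obtain ⟨p, hp⟩ : ∃ p : Pt d → Pt d, ∀ y, p y = y + (g y - ⟪e, y⟫_ℝ) • e := ⟨_, fun _ => rfl⟩
  have hpc : Continuous p := by
    rw [funext hp]
    fun_prop
  have hpe : ∀ (y : Pt d) (t : ℝ), p (y + t • e) = p y := by
    intro y t
    simp only [hp, hge, inner_add_right, inner_smul_right, hee]
    module
  have hpg : ∀ y, g (p y) = ⟪e, p y⟫_ℝ := by
    intro y
    simp only [hp, hge, inner_add_right, inner_smul_right, hee]
    ring
  have hUo : IsOpen (p ⁻¹' W) := hW.preimage hpc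
  have hxU : x₀ ∈ p ⁻¹' W := by
    rw [mem_preimage, hp, hgx₀, sub_self, zero_smul, add_zero]
    exact hx₀
  -- Baire: the space is covered by the closed set where `p` misses `W` (index `none`) and the
  -- preimages under `p` of the finitely many hyperplanes. One of the latter has interior points
  -- inside `p ⁻¹' W`.
  have hdense := dense_iUnion_interior_of_closed
    (f := fun i : Option F => i.elim (p ⁻¹' W)ᶜ fun q => p ⁻¹' hyperplane q.1.1 q.1.2)
    (by
      rintro (_ | q)
      · exact hUo.isClosed_compl
      · exact (isClosed_hyperplane _ _).preimage hpc)
    (by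
      refine eq_univ_of_forall fun y => ?_
      by_cases hy : y ∈ p ⁻¹' W
      · obtain ⟨q, hq, hyq⟩ := hF (p y) hy (hpg y)
        exact mem_iUnion.2 ⟨some ⟨q, hq⟩, hyq⟩
      · exact mem_iUnion.2 ⟨none, hy⟩)
  obtain ⟨y₁, hy₁U, hy₁⟩ := hdense.inter_open_nonempty _ hUo ⟨x₀, hxU⟩
  obtain ⟨i, hi⟩ := mem_iUnion.1 hy₁
  obtain _ | ⟨⟨m, c⟩, hq⟩ := i
  · exact absurd hy₁U (interior_subset hi)
  have hm0 : m ≠ 0 := hF0 _ hq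
  replace hi : ∀ᶠ y in 𝓝 y₁, ⟪m, p y⟫_ℝ = c := mem_interior_iff_mem_nhds.1 hi
  clear hy₁ hdense
  -- If `m` were orthogonal to `e`, then `⟪m, p y⟫ = ⟪m, y⟫`, which is not constant as `y` moves in
  -- the direction `m`.
  have hme : ⟪m, e⟫_ℝ ≠ 0 := by
    intro h0
    have h1 : ∀ᶠ t : ℝ in 𝓝 0, ⟪m, p (y₁ + t • m)⟫_ℝ = c := by
      have hc : Continuous fun t : ℝ => y₁ + t • m := by fun_prop
      exact (hc.tendsto' 0 y₁ (by simp)).eventually hi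
    obtain ⟨t, ht, ht0⟩ := ((h1.filter_mono nhdsWithin_le_nhds).and
      (self_mem_nhdsWithin : ({0}ᶜ : Set ℝ) ∈ 𝓝[≠] 0)).exists
    have h2 := hi.self_of_nhds
    simp only [hp, inner_add_right, inner_smul_right, h0, mul_zero, add_zero] at h2 ht
    rw [h2] at ht
    have : t * ⟪m, m⟫_ℝ = 0 := by linarith
    exact (mul_ne_zero ht0 (inner_self_ne_zero.2 hm0)) this
  have hmx₁ : ⟪m, p y₁⟫_ℝ = c := hi.self_of_nhds
  -- As `p` is invariant along `e`, the identity near `y₁` moves to a neighbourhood of the graph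
  -- point `p y₁`.
  have hloc : ∀ᶠ y in 𝓝 (p y₁), ⟪m, p y⟫_ℝ = c := by
    have hc : Continuous fun y : Pt d => y + (-(g y₁ - ⟪e, y₁⟫_ℝ)) • e := by fun_prop
    have h1 := (hc.tendsto' (p y₁) y₁ (by rw [hp]; module)).eventually hi
    filter_upwards [h1] with y hy
    rwa [hpe] at hy
  obtain ⟨ρ, hρ, hρb⟩ := Metric.eventually_nhds_iff_ball.1 (hloc.and (hW.mem_nhds hy₁U))
  -- This vector results from solving `⟪m, y⟫ + (g y - ⟪e, y⟫) * ⟪m, e⟫ = c` for `g y - ⟪e, y⟫`.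
  refine ⟨p y₁, (-(⟪m, e⟫_ℝ)⁻¹) • m, ρ, by simp [hme, hm0], hρ,
    fun y hy => ⟨(hρb y hy).2, ?_⟩⟩
  have h1 := (hρb y hy).1
  rw [hp, inner_add_right, inner_smul_right] at h1
  rw [real_inner_smul_left, inner_sub_right, hmx₁]
  field_simp
  linarith

/-- There is a point of the interface near which the interface is flat. -/
theorem IsStokesDarcyGeometry.exists_flat {Ω ΩS ΩD : Set (Pt d)}
    (hΩ : IsStokesDarcyGeometry Ω ΩS ΩD) :
    ∃ (x n : Pt d) (r : ℝ), ‖n‖ = 1 ∧ 0 < r ∧ ∀ y ∈ Metric.ball x r,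
      (y ∈ ΩS ↔ ⟪n, y - x⟫_ℝ < 0) ∧ (y ∈ ΩD ↔ 0 < ⟪n, y - x⟫_ℝ) := by
  have hSo := hΩ.domain_S.isOpen
  have hDo := hΩ.domain_D.isOpen
  -- Otherwise the connected set `Ω` would be the union of two disjoint nonempty open sets.
  obtain ⟨x₀, hx₀, hxI⟩ : (Ω ∩ interface ΩS ΩD).Nonempty := by
    rw [nonempty_iff_ne_empty]
    intro h0
    have hu := hΩ.union_eq
    rw [h0, union_empty] at hu
    obtain ⟨z, -, hz⟩ := hΩ.domain.isConnected.isPreconnected ΩS ΩD hSo hDo hu.ge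
      (by rw [← hu, union_inter_cancel_left]; exact hΩ.domain_S.isConnected.nonempty)
      (by rw [← hu, union_inter_cancel_right]; exact hΩ.domain_D.isConnected.nonempty)
    exact hΩ.disjoint.le_bot hz
  obtain ⟨e, g, K, r, he, hgL, hge, hr, hball⟩ := hΩ.domain_S.lipschitz x₀ hxI.1
  obtain ⟨F, hF0, hF⟩ := hΩ.domain_S.polyhedral
  have hfront : ∀ {y}, y ∈ Metric.ball x₀ r → (y ∈ frontier ΩS ↔ g y = ⟪e, y⟫_ℝ) :=
    fun {y} hy => mem_frontier_iff_graph hSo hgL.continuous he hge hball hy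
  obtain ⟨x, w, ρ, hw, hρ, h⟩ := exists_affine_point hgL.continuous he hge
    (Metric.isOpen_ball.inter hΩ.domain.isOpen) hF0
    (fun y hy hgy => hF y ((hfront hy.1).2 hgy)) ⟨Metric.mem_ball_self hr, hx₀⟩
    ((hfront (Metric.mem_ball_self hr)).1 hxI.1)
  have hpos : 0 < ‖w‖⁻¹ := inv_pos.2 (norm_pos_iff.2 hw)
  refine ⟨x, ‖w‖⁻¹ • w, ρ, norm_smul_inv_norm hw, hρ, fun y hy => ?_⟩
  obtain ⟨⟨hy1, hyΩ⟩, hy3⟩ := h y hy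
  rw [real_inner_smul_left, mul_pos_iff_of_pos_left hpos, ← smul_eq_mul,
    smul_neg_iff_of_pos_left hpos, ← hy3, sub_neg, sub_pos]
  -- A point of `ΩD` avoids the closure of `ΩS`, so it lies strictly below the graph. Conversely, a
  -- point of `Ω` strictly below it is neither in `ΩS` nor on the interface.
  refine ⟨hball y hy1, fun hyD => ?_, fun hlt => ?_⟩
  · have hcl : y ∉ closure ΩS :=
      fun h => (hΩ.disjoint.closure_left hDo).le_bot ⟨h, hyD⟩
    have hn1 : ¬ g y < ⟪e, y⟫_ℝ := fun h => hcl (subset_closure ((hball y hy1).2 h))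
    have hn2 : g y ≠ ⟪e, y⟫_ℝ := fun h =>
      hcl (frontier_subset_closure ((hfront hy1).2 h))
    exact lt_of_le_of_ne (not_lt.1 hn1) hn2.symm
  · rw [← hΩ.union_eq] at hyΩ
    rcases hyΩ with (h | h) | h
    · exact absurd ((hball y hy1).1 h) hlt.not_gt
    · exact h
    · exact absurd ((hfront hy1).1 h.2.1) hlt.ne'

/-! ### The trace inequality -/

/-- The `L¹` norm on `S` is bounded by the `W^{1,1}` norm in `O` for smooth functions. -/
def HasTraceBound (O S : Set (Pt d)) : Prop :=
  ∃ C : NNReal, ∀ φ : Pt d → ℝ, ContDiff ℝ ∞ φ →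
    ∫⁻ y in S, ‖φ y‖ₑ ∂(μHE[d - 1] : Measure (Pt d)) ≤ C * ∫⁻ y in O, (‖φ y‖ₑ + ‖∇ φ y‖ₑ)

theorem hasTraceBound_empty (O : Set (Pt d)) : HasTraceBound O ∅ := ⟨0, by simp⟩

theorem HasTraceBound.mono {O S T : Set (Pt d)} (h : HasTraceBound O T) (hST : S ⊆ T) :
    HasTraceBound O S := by
  obtain ⟨C, hC⟩ := h
  exact ⟨C, fun φ hφ => (lintegral_mono_set hST).trans (hC φ hφ)⟩

theorem HasTraceBound.union {O S T : Set (Pt d)} (hS : HasTraceBound O S)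
    (hT : HasTraceBound O T) : HasTraceBound O (S ∪ T) := by
  obtain ⟨C, hC⟩ := hS
  obtain ⟨C', hC'⟩ := hT
  refine ⟨C + C', fun φ hφ => (lintegral_union_le _ _ _).trans ?_⟩
  push_cast
  rw [add_mul]
  exact add_le_add (hC φ hφ) (hC' φ hφ)

theorem HasTraceBound.biUnion {ι : Type*} {O : Set (Pt d)} {S : ι → Set (Pt d)} (F : Finset ι)
    (h : ∀ i ∈ F, HasTraceBound O (S i)) : HasTraceBound O (⋃ i ∈ F, S i) := by
  classical
  induction F using Finset.induction_on with
  | empty => simpa using hasTraceBound_empty O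
  | insert a F _ ih =>
    rw [Finset.set_biUnion_insert]
    exact (h a (Finset.mem_insert_self a F)).union
      (ih fun i hi => h i (Finset.mem_insert_of_mem hi))

/-- A direction can be perturbed to be transversal to finitely many hyperplanes. -/
theorem exists_transversal_direction {e : Pt d} (he : ‖e‖ = 1) (K : NNReal)
    (F : Finset (Pt d × ℝ)) (hF : ∀ q ∈ F, q.1 ≠ 0) :
    ∃ e' : Pt d, (∀ q ∈ F, ⟪q.1, e'⟫_ℝ ≠ 0) ∧ K * ‖e' - e‖ < ⟪e, e'⟫_ℝ ∧ ‖e'‖ < 2 := by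
  -- Each condition removes a proper subspace, so the good directions are dense. The remaining two
  -- conditions are open and hold at `e`.
  have hd : Dense (⋂ q ∈ (F : Set (Pt d × ℝ)), {y : Pt d | ⟪q.1, y⟫_ℝ ≠ 0}) := by
    refine dense_biInter_of_isOpen (fun q _ => ?_) F.countable_toSet fun q hq => ?_
    · exact isOpen_ne_fun (by fun_prop) continuous_const
    · change Dense ({y : Pt d | ⟪q.1, y⟫_ℝ = 0}ᶜ)
      rw [← interior_eq_empty_iff_dense_compl, ← not_nonempty_iff_eq_empty]
      intro h
      have h0 := Submodule.eq_top_of_nonempty_interior'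
        (LinearMap.ker (innerSL ℝ q.1).toLinearMap) h
      have h1 : q.1 ∈ LinearMap.ker (innerSL ℝ q.1).toLinearMap := h0 ▸ Submodule.mem_top
      exact hF q hq (by simpa using h1)
  have ho : IsOpen {y : Pt d | K * ‖y - e‖ < ⟪e, y⟫_ℝ ∧ ‖y‖ < 2} :=
    (isOpen_lt (f := fun y : Pt d => K * ‖y - e‖) (g := fun y => ⟪e, y⟫_ℝ) (by fun_prop)
      (by fun_prop)).inter (isOpen_lt (f := fun y : Pt d => ‖y‖) (by fun_prop) (by fun_prop))
  obtain ⟨e', h1, h2⟩ := hd.inter_open_nonempty _ ho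
    ⟨e, by simp [he], by rw [he]; norm_num⟩
  exact ⟨e', fun q hq => mem_iInter₂.1 h2 q hq, h1⟩

theorem hasDerivAt_comp_line {φ : Pt d → ℝ} (hφ : ContDiff ℝ ∞ φ) (y e : Pt d) (t : ℝ) :
    HasDerivAt (fun t : ℝ => φ (y + t • e)) ⟪∇ φ (y + t • e), e⟫_ℝ t := by
  have h1 := (hφ.differentiable (by simp) (y + t • e)).hasGradientAt.hasFDerivAt
  have h2 : HasDerivAt (fun t : ℝ => y + t • e) e t := by
    simpa using ((hasDerivAt_id t).smul_const e).const_add y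
  exact h1.comp_hasDerivAt t h2

/-- A value of a smooth function is bounded by an integral along a segment. -/
theorem mul_enorm_le_lintegral_segment {φ : Pt d → ℝ} (hφ : ContDiff ℝ ∞ φ) (y : Pt d) {e : Pt d}
    (he : ‖e‖ ≤ 2) {τ : ℝ} :
    ENNReal.ofReal τ * ‖φ y‖ₑ ≤ (1 + ENNReal.ofReal τ * 2) *
      ∫⁻ t in Ioo 0 τ, (‖φ (y + t • e)‖ₑ + ‖∇ φ (y + t • e)‖ₑ) := by
  have hgc := continuous_gradient' hφ
  have hφc := hφ.continuous
  set A : ℝ≥0∞ := ∫⁻ t in Ioo 0 τ, (‖φ (y + t • e)‖ₑ + ‖∇ φ (y + t • e)‖ₑ) with hA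
  have hB : ∫⁻ t in Ioo 0 τ, ‖∇ φ (y + t • e)‖ₑ ≤ A := lintegral_mono fun t => le_add_self
  have hE : ‖e‖ₑ ≤ 2 := by
    rw [← ofReal_norm]
    exact (ENNReal.ofReal_le_ofReal he).trans (by simp)
  -- The fundamental theorem of calculus bounds `φ y` by each value on the segment plus the
  -- integrated gradient, with `2` for the length of `e`. The claim follows by integrating over `t`.
  have hpt : ∀ t ∈ Ioo 0 τ, ‖φ y‖ₑ ≤ ‖φ (y + t • e)‖ₑ + 2 * A := by
    intro t ht
    have hint : ∫ s in (0 : ℝ)..t, ⟪∇ φ (y + s • e), e⟫_ℝ = φ (y + t • e) - φ y := by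
      rw [intervalIntegral.integral_eq_sub_of_hasDerivAt
        (fun s _ => hasDerivAt_comp_line hφ y e s)
        (Continuous.intervalIntegrable (by fun_prop) _ _)]
      simp
    have hφy : φ y = φ (y + t • e) - ∫ s in (0 : ℝ)..t, ⟪∇ φ (y + s • e), e⟫_ℝ := by
      rw [hint]; ring
    calc ‖φ y‖ₑ ≤ ‖φ (y + t • e)‖ₑ + ‖∫ s in (0 : ℝ)..t, ⟪∇ φ (y + s • e), e⟫_ℝ‖ₑ := by
          conv_lhs => rw [hφy]
          exact enorm_sub_le
      _ ≤ _ := by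
        gcongr
        rw [intervalIntegral.integral_of_le ht.1.le]
        calc _ ≤ ∫⁻ s in Ioc 0 t, ‖⟪∇ φ (y + s • e), e⟫_ℝ‖ₑ := enorm_integral_le_lintegral_enorm _
          _ ≤ ∫⁻ s in Ioo 0 τ, ‖⟪∇ φ (y + s • e), e⟫_ℝ‖ₑ :=
            lintegral_mono_set fun s hs => ⟨hs.1, hs.2.trans_lt ht.2⟩
          _ ≤ ∫⁻ s in Ioo 0 τ, 2 * ‖∇ φ (y + s • e)‖ₑ := by
            refine lintegral_mono fun s => ?_
            have h1 : ‖⟪∇ φ (y + s • e), e⟫_ℝ‖ₑ ≤ ‖∇ φ (y + s • e)‖ₑ * ‖e‖ₑ := by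
              simp only [← ofReal_norm]
              rw [← ENNReal.ofReal_mul (norm_nonneg _)]
              exact ENNReal.ofReal_le_ofReal (norm_inner_le_norm _ _)
            rw [mul_comm]
            exact h1.trans (mul_le_mul_right hE _)
          _ = 2 * ∫⁻ s in Ioo 0 τ, ‖∇ φ (y + s • e)‖ₑ := lintegral_const_mul' _ _ (by simp)
          _ ≤ _ := by gcongr
  calc ENNReal.ofReal τ * ‖φ y‖ₑ = ∫⁻ t in Ioo 0 τ, ‖φ y‖ₑ := by
        rw [setLIntegral_const, Real.volume_Ioo, sub_zero, mul_comm]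
    _ ≤ ∫⁻ t in Ioo 0 τ, (‖φ (y + t • e)‖ₑ + 2 * A) := setLIntegral_mono' measurableSet_Ioo hpt
    _ = (∫⁻ t in Ioo 0 τ, ‖φ (y + t • e)‖ₑ) + ENNReal.ofReal τ * (2 * A) := by
        rw [lintegral_add_right _ measurable_const, setLIntegral_const, Real.volume_Ioo, sub_zero,
          mul_comm (2 * A)]
    _ ≤ A + ENNReal.ofReal τ * (2 * A) := by
        gcongr
        exact lintegral_mono fun t => le_self_add
    _ = _ := by ring

/-- The trace bound on a piece of a hyperplane from which a transversal cone enters `O`. -/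
theorem hasTraceBound_hyperplane {O S : Set (Pt d)} (hO : IsOpen O) {n e : Pt d} {c τ : ℝ}
    (hne : ⟪n, e⟫_ℝ ≠ 0) (he : ‖e‖ ≤ 2) (hτ : 0 < τ) (hS : S ⊆ hyperplane n c)
    (h : ∀ y ∈ S, ∀ t ∈ Ioo 0 τ, y + t • e ∈ O) : HasTraceBound O S := by
  have hn : n ≠ 0 := by rintro rfl; simp at hne
  obtain ⟨κ, -, hκ⟩ := exists_map_prod_hyperplane hne c
  have := sigmaFinite_restrict_hyperplane hn c
  refine ⟨(Real.toNNReal τ)⁻¹ * (1 + Real.toNNReal τ * 2) * κ, fun φ hφ => ?_⟩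
  have hgc := continuous_gradient' hφ
  have hφc := hφ.continuous
  -- Extension by zero replaces the segment by the whole line, so that the change of variables on
  -- the full space applies. `S` need not be measurable, only the majorant.
  set G : Pt d → ℝ≥0∞ := O.indicator fun z => ‖φ z‖ₑ + ‖∇ φ z‖ₑ with hG
  have hGm : Measurable G := (Continuous.measurable (by fun_prop)).indicator hO.measurableSet
  have hτ0 : Real.toNNReal τ ≠ 0 := by simpa using hτ
  set a : ℝ≥0∞ := (((Real.toNNReal τ)⁻¹ * (1 + Real.toNNReal τ * 2) : NNReal) : ℝ≥0∞) with ha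
  have hpt : ∀ y ∈ S, ‖φ y‖ₑ ≤ a * ∫⁻ t : ℝ, G (y + t • e) := by
    intro y hy
    have h1 := mul_enorm_le_lintegral_segment hφ y he (τ := τ)
    have h2 : ∫⁻ t in Ioo 0 τ, (‖φ (y + t • e)‖ₑ + ‖∇ φ (y + t • e)‖ₑ) ≤
        ∫⁻ t : ℝ, G (y + t • e) := by
      refine le_trans (le_of_eq ?_) (setLIntegral_le_lintegral (Ioo 0 τ) _)
      refine setLIntegral_congr_fun measurableSet_Ioo fun t ht => ?_
      simp only [hG]
      rw [indicator_of_mem (h y hy t ht)]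
    have h3 : ENNReal.ofReal τ ≠ 0 := by simpa using hτ
    calc ‖φ y‖ₑ = (ENNReal.ofReal τ)⁻¹ * (ENNReal.ofReal τ * ‖φ y‖ₑ) := by
          rw [← mul_assoc, ENNReal.inv_mul_cancel h3 ENNReal.ofReal_ne_top, one_mul]
      _ ≤ (ENNReal.ofReal τ)⁻¹ * ((1 + ENNReal.ofReal τ * 2) * ∫⁻ t : ℝ, G (y + t • e)) := by
          exact mul_le_mul_right (h1.trans (mul_le_mul_right h2 _)) _
      _ = _ := by
          rw [ha, ENNReal.coe_mul, ENNReal.coe_inv hτ0, ← mul_assoc]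
          simp [ENNReal.ofReal]
  calc ∫⁻ y in S, ‖φ y‖ₑ ∂(μHE[d - 1] : Measure (Pt d))
      ≤ ∫⁻ y in S, (a * ∫⁻ t : ℝ, G (y + t • e)) ∂(μHE[d - 1] : Measure (Pt d)) := by
        refine setLIntegral_mono ?_ hpt
        exact (Measurable.lintegral_prod_right' (f := fun q : Pt d × ℝ => G (q.1 + q.2 • e))
          (hGm.comp (by fun_prop))).const_mul a
    _ ≤ ∫⁻ y in hyperplane n c, (a * ∫⁻ t : ℝ, G (y + t • e)) ∂(μHE[d - 1] : Measure (Pt d)) :=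
        lintegral_mono_set hS
    _ = a * ∫⁻ q : Pt d × ℝ, G (q.1 + q.2 • e)
          ∂(((μHE[d - 1] : Measure (Pt d)).restrict (hyperplane n c)).prod volume) := by
        rw [lintegral_const_mul' _ _ ENNReal.coe_ne_top,
          lintegral_prod (fun q : Pt d × ℝ => G (q.1 + q.2 • e))
            (hGm.comp (by fun_prop)).aemeasurable]
    _ = a * (κ * ∫⁻ z, G z) := by
        rw [← lintegral_map hGm (g := fun q : Pt d × ℝ => q.1 + q.2 • e) (by fun_prop), hκ,
          lintegral_smul_measure]
        rfl
    _ = _ := by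
        rw [hG, lintegral_indicator hO.measurableSet, ← mul_assoc, ENNReal.coe_mul _ κ]

/-- The trace inequality in `L¹`. -/
theorem IsPolyhedralLipschitzDomain.hasTraceBound {O : Set (Pt d)}
    (hO : IsPolyhedralLipschitzDomain O) : HasTraceBound O (frontier O) := by
  obtain ⟨F, hF0, hF⟩ := hO.polyhedral
  have hcpt : IsCompact (frontier O) :=
    hO.isBounded.isCompact_closure.of_isClosed_subset isClosed_frontier frontier_subset_closure
  refine hcpt.induction_on (p := HasTraceBound O) (hasTraceBound_empty O)
    (fun _ _ hst ht => ht.mono hst) (fun _ _ hs ht => hs.union ht) fun x hx => ?_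
  obtain ⟨e, g, K, r, he, hgL, hge, hr, hball⟩ := hO.lipschitz x hx
  obtain ⟨e', he'F, he'K, he'2⟩ := exists_transversal_direction he K F hF0
  refine ⟨frontier O ∩ Metric.ball x (r / 2),
    inter_mem self_mem_nhdsWithin (mem_nhdsWithin_of_mem_nhds (Metric.ball_mem_nhds x (by simpa))),
    (HasTraceBound.biUnion (S := fun q => frontier O ∩ Metric.ball x (r / 2) ∩ hyperplane q.1 q.2)
      F fun q hq => ?_).mono ?_⟩
  -- Since `‖e'‖ < 2`, times below `r / 4` displace a point of the half ball by at most `r / 2`, so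
  -- it stays in the ball where the graph description holds.
  · refine hasTraceBound_hyperplane (c := q.2) (τ := r / 4) hO.isOpen (he'F q hq) he'2.le
      (by positivity) inter_subset_right ?_
    rintro y ⟨⟨hyO, hyb⟩, -⟩ t ⟨ht0, ht⟩
    rw [Metric.mem_ball] at hyb
    have hyr : y ∈ Metric.ball x r := by
      rw [Metric.mem_ball]; linarith
    have hyt : y + t • e' ∈ Metric.ball x r := by
      have h1 : dist (y + t • e') y ≤ r / 4 * 2 := by
        rw [dist_eq_norm, add_sub_cancel_left, norm_smul, Real.norm_of_nonneg ht0.le]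
        exact mul_le_mul ht.le he'2.le (norm_nonneg _) (by positivity)
      rw [Metric.mem_ball]
      linarith [dist_triangle (y + t • e') y x]
    rw [hball _ hyt]
    have hgy := (mem_frontier_iff_graph hO.isOpen hgL.continuous he hge hball hyr).1 hyO
    -- Only `e' - e` affects `g`. The rise of `g` is at most `K * t * ‖e' - e‖`, less than the gain
    -- `t * ⟪e, e'⟫` in height.
    have h2 : g (y + t • e') = g (y + t • (e' - e)) := by
      rw [← hge (y + t • (e' - e)) t]
      congr 1
      module
    have h3 : g (y + t • (e' - e)) ≤ g y + K * (t * ‖e' - e‖) := by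
      have h4 := hgL.dist_le_mul (y + t • (e' - e)) y
      rw [dist_eq_norm, dist_eq_norm, add_sub_cancel_left, norm_smul,
        Real.norm_of_nonneg ht0.le] at h4
      linarith [(Real.norm_eq_abs _ ▸ le_abs_self (g (y + t • (e' - e)) - g y) :
        g (y + t • (e' - e)) - g y ≤ ‖g (y + t • (e' - e)) - g y‖)]
    rw [h2, inner_add_right, inner_smul_right]
    nlinarith [mul_lt_mul_of_pos_left he'K ht0]
  · rintro y ⟨hy1, hy2⟩
    obtain ⟨q, hq, hyq⟩ := hF y hy1
    exact mem_iUnion₂.2 ⟨q, hq, ⟨hy1, hy2⟩, hyq⟩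

/-- The boundary of a polyhedral Lipschitz domain has finite surface measure. -/
theorem IsPolyhedralLipschitzDomain.isFiniteMeasure_surf {O : Set (Pt d)}
    (hO : IsPolyhedralLipschitzDomain O) : IsFiniteMeasure (surf (frontier O)) := by
  obtain ⟨C, hC⟩ := hO.hasTraceBound
  -- For the constant function one the trace bound compares surface measure with volume.
  have h := hC (fun _ => 1) contDiff_const
  have h0 : ∀ y : Pt d, ∇ (fun _ : Pt d => (1 : ℝ)) y = 0 := fun y => gradient_fun_const ..
  simp only [h0, enorm_zero, add_zero, enorm_one, lintegral_const, one_mul,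
    Measure.restrict_apply_univ] at h
  constructor
  rw [surf, Measure.restrict_apply_univ]
  exact h.trans_lt (ENNReal.mul_lt_top ENNReal.coe_lt_top hO.isBounded.measure_lt_top)

/-! ### The outward normal -/

/-- By scaling, two open half-spaces that agree near `x` agree everywhere, and a half-space
determines its unit normal. This makes the chosen value of `outwardNormal` computable. -/
theorem IsOutwardNormal.unique {O : Set (Pt d)} {x n n' : Pt d} (h : IsOutwardNormal O x n)
    (h' : IsOutwardNormal O x n') : n = n' := by
  obtain ⟨hn, r, hr, h⟩ := h
  obtain ⟨hn', r', hr', h'⟩ := h'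
  have key : ∀ z : Pt d, ⟪n, z⟫_ℝ < 0 ↔ ⟪n', z⟫_ℝ < 0 := by
    intro z
    have hc : Continuous fun t : ℝ => x + t • z := by fun_prop
    have h1 : Tendsto (fun t : ℝ => x + t • z) (𝓝[>] 0) (𝓝 x) :=
      (hc.tendsto' 0 x (by simp)).mono_left nhdsWithin_le_nhds
    obtain ⟨t, ⟨ht1, ht2⟩, ht0⟩ := ((h1.eventually (inter_mem (Metric.ball_mem_nhds x hr)
      (Metric.ball_mem_nhds x hr'))).and (self_mem_nhdsWithin : Ioi (0 : ℝ) ∈ 𝓝[>] 0)).exists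
    have h2 := (h _ ht1).symm.trans (h' _ ht2)
    rwa [add_sub_cancel_left, inner_smul_right, inner_smul_right, ← smul_eq_mul, ← smul_eq_mul,
      smul_neg_iff_of_pos_left ht0, smul_neg_iff_of_pos_left ht0] at h2
  have hnn : ⟪n, n⟫_ℝ = 1 := by rw [real_inner_self_eq_norm_sq, hn]; norm_num
  have hnn' : ⟪n', n'⟫_ℝ = 1 := by rw [real_inner_self_eq_norm_sq, hn']; norm_num
  have hz : ∀ z : Pt d, ⟪n, z⟫_ℝ = 0 → ⟪n', z⟫_ℝ = 0 := by
    intro z hz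
    have h1 := (key z).not.1 (by simp [hz])
    have h2 := (key (-z)).not.1 (by simp [hz])
    rw [inner_neg_right] at h2
    linarith
  have h1 : 0 < ⟪n, n'⟫_ℝ := by
    have := (key (-n)).1 (by rw [inner_neg_right, hnn]; norm_num)
    rw [inner_neg_right, real_inner_comm] at this
    linarith
  -- The component of `n'` orthogonal to `n` is also orthogonal to `n'`, whence `⟪n, n'⟫ ^ 2 = 1`;
  -- positivity selects the value one.
  have h2 := hz (n' - ⟪n, n'⟫_ℝ • n) (by rw [inner_sub_right, inner_smul_right, hnn]; ring)
  rw [inner_sub_right, inner_smul_right, hnn', real_inner_comm n n'] at h2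
  have h3 : ⟪n, n'⟫_ℝ = 1 := by nlinarith
  exact (inner_eq_one_iff_of_norm_eq_one hn hn').1 h3

theorem IsOutwardNormal.outwardNormal_eq {O : Set (Pt d)} {x n : Pt d}
    (h : IsOutwardNormal O x n) : outwardNormal O x = n := by
  have he : ∃ n, IsOutwardNormal O x n := ⟨n, h⟩
  rw [outwardNormal, dif_pos he]
  exact he.choose_spec.unique h

theorem norm_outwardNormal_le (O : Set (Pt d)) (x : Pt d) : ‖outwardNormal O x‖ ≤ 1 := by
  by_cases he : ∃ n, IsOutwardNormal O x n
  · obtain ⟨n, hn⟩ := he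
    rw [hn.outwardNormal_eq, hn.1]
  · rw [outwardNormal, dif_neg he, norm_zero]
    exact zero_le_one

theorem isOutwardNormal_of_mem_ball {O : Set (Pt d)} {x n : Pt d} {r : ℝ} (hn : ‖n‖ = 1)
    (h : ∀ y ∈ Metric.ball x r, y ∈ O ↔ ⟪n, y - x⟫_ℝ < 0) {y : Pt d} (hy : y ∈ Metric.ball x r)
    (hy0 : ⟪n, y - x⟫_ℝ = 0) : IsOutwardNormal O y n := by
  refine ⟨hn, r - dist y x, sub_pos.2 hy, fun z hz => ?_⟩
  rw [h z (by
    rw [Metric.mem_ball] at hz ⊢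
    linarith [dist_triangle z y x])]
  rw [← sub_add_sub_cancel z y x, inner_add_right, hy0, add_zero]

/-- Near a flat boundary point, the boundary is the tangent hyperplane. -/
theorem mem_frontier_iff_flat {O : Set (Pt d)} {x n : Pt d} {r : ℝ} (hn : ‖n‖ = 1)
    (h : ∀ y ∈ Metric.ball x r, y ∈ O ↔ ⟪n, y - x⟫_ℝ < 0) {y : Pt d} (hy : y ∈ Metric.ball x r) :
    y ∈ frontier O ↔ ⟪n, y - x⟫_ℝ = 0 := by
  have hball := Metric.isOpen_ball.mem_nhds hy
  have hev : ∀ᶠ z in 𝓝 y, z ∈ O ↔ ⟪n, z - x⟫_ℝ < 0 := by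
    filter_upwards [hball] with z hz using h z hz
  have hcn : Continuous fun z : Pt d => ⟪n, z - x⟫_ℝ := by fun_prop
  have hnn : ⟪n, n⟫_ℝ = 1 := by rw [real_inner_self_eq_norm_sq, hn]; norm_num
  constructor
  · intro hf
    rcases lt_trichotomy ⟪n, y - x⟫_ℝ 0 with hlt | heq | hgt
    · refine absurd (mem_interior_iff_mem_nhds.2 ?_) hf.2
      filter_upwards [hev, hcn.continuousAt.eventually_lt_const hlt] with z h1 h2 using h1.2 h2
    · exact heq
    · refine absurd hf.1 ?_
      rw [mem_closure_iff_frequently, not_frequently]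
      filter_upwards [hev, hcn.continuousAt.eventually_const_lt hgt] with z h1 h2
      rw [h1]
      exact h2.not_gt
  · intro h0
    have hc : ∀ s : ℝ, Tendsto (fun t : ℝ => y + (s * t) • n) (𝓝[>] 0) (𝓝 y) := by
      intro s
      have hc : Continuous fun t : ℝ => y + (s * t) • n := by fun_prop
      exact (hc.tendsto' 0 y (by simp)).mono_left nhdsWithin_le_nhds
    have hin : ∀ s t : ℝ, ⟪n, y + (s * t) • n - x⟫_ℝ = s * t := by
      intro s t
      rw [add_sub_right_comm, inner_add_right, h0, inner_smul_right, hnn]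
      ring
    rw [frontier_eq_closure_inter_closure]
    constructor
    · refine mem_closure_of_tendsto (hc (-1)) ?_
      filter_upwards [(hc (-1)).eventually hev, self_mem_nhdsWithin] with t h1 h2
      rw [h1, hin]
      simpa using h2
    · refine mem_closure_of_tendsto (hc 1) ?_
      filter_upwards [(hc 1).eventually hev, self_mem_nhdsWithin] with t h1 h2
      rw [mem_compl_iff, h1, hin, one_mul, not_lt]
      exact le_of_lt h2

/-- Every boundary point in a ball where `O` is a half-space is itself flat, so the flat set is the
boundary intersected with a union of open balls. -/
theorem measurableSet_flat (O : Set (Pt d)) :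
    MeasurableSet {x | ∃ n, IsOutwardNormal O x n} := by
  have h : {x | ∃ n, IsOutwardNormal O x n} =
      frontier O ∩ ⋃ p ∈ {p : Pt d × ℝ | ∃ n : Pt d, ‖n‖ = 1 ∧
        ∀ y ∈ Metric.ball p.1 p.2, y ∈ O ↔ ⟪n, y - p.1⟫_ℝ < 0}, Metric.ball p.1 p.2 := by
    ext x
    constructor
    · rintro ⟨n, hn, r, hr, h⟩
      refine ⟨(mem_frontier_iff_flat hn h (Metric.mem_ball_self hr)).2 (by simp),
        mem_iUnion₂.2 ⟨(x, r), ⟨n, hn, h⟩, Metric.mem_ball_self hr⟩⟩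
    · rintro ⟨hx, hx'⟩
      obtain ⟨⟨y, r⟩, ⟨n, hn, h⟩, hxr⟩ := mem_iUnion₂.1 hx'
      exact ⟨n, isOutwardNormal_of_mem_ball hn h hxr ((mem_frontier_iff_flat hn h hxr).1 hx)⟩
  rw [h]
  exact isClosed_frontier.measurableSet.inter
    (isOpen_biUnion fun p _ => Metric.isOpen_ball).measurableSet

/-- The normal is locally constant, hence continuous, on the flat set and zero elsewhere. -/
theorem aestronglyMeasurable_outwardNormal (O : Set (Pt d)) (μ : Measure (Pt d)) :
    AEStronglyMeasurable (outwardNormal O) μ := by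
  have hind : outwardNormal O =
      {x | ∃ n, IsOutwardNormal O x n}.indicator (outwardNormal O) := by
    ext1 x
    by_cases he : ∃ n, IsOutwardNormal O x n
    · rw [indicator_of_mem (by exact he)]
    · rw [indicator_of_notMem (by exact he), outwardNormal, dif_neg he]
  rw [hind, aestronglyMeasurable_indicator_iff (measurableSet_flat O)]
  refine ContinuousOn.aestronglyMeasurable ?_ (measurableSet_flat O)
  rintro x ⟨n, hn⟩
  have hev : outwardNormal O =ᶠ[𝓝[{x | ∃ n, IsOutwardNormal O x n}] x] fun _ => n := by
    obtain ⟨hn1, r, hr, h⟩ := hn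
    filter_upwards [self_mem_nhdsWithin, mem_nhdsWithin_of_mem_nhds (Metric.ball_mem_nhds x hr)]
      with y hy hyb
    obtain ⟨m, hm, ρ, hρ, hy⟩ := hy
    have hyf : y ∈ frontier O :=
      (mem_frontier_iff_flat hm hy (Metric.mem_ball_self hρ)).2 (by simp)
    exact (isOutwardNormal_of_mem_ball hn1 h hyb
      ((mem_frontier_iff_flat hn1 h hyb).1 hyf)).outwardNormal_eq
  exact continuousWithinAt_const.congr_of_eventuallyEq hev hn.outwardNormal_eq

/-! ### Bounds for traces -/

theorem lintegral_enorm_le_eLpNorm_two {F : Type*} [NormedAddCommGroup F] {μ : Measure (Pt d)}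
    {f : Pt d → F} (hf : AEStronglyMeasurable f μ) :
    ∫⁻ x, ‖f x‖ₑ ∂μ ≤ eLpNorm f 2 μ * μ univ ^ (2⁻¹ : ℝ) := by
  rw [← eLpNorm_one_eq_lintegral_enorm]
  refine (eLpNorm_le_eLpNorm_mul_rpow_measure_univ (q := 2) (by norm_num) hf).trans (le_of_eq ?_)
  norm_num

theorem lintegral_enorm_le_of_approx {F : Type*} [NormedAddCommGroup F] {μ : Measure (Pt d)}
    {f : Pt d → F} (hf : AEStronglyMeasurable f μ) (g : Lp F 2 μ) {N : ℝ≥0∞} (hN : ‖g‖ₑ ≤ N) :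
    ∫⁻ x, ‖f x‖ₑ ∂μ ≤ (eLpNorm (fun x => f x - g x) 2 μ + N) * μ univ ^ (2⁻¹ : ℝ) := by
  have hg := Lp.aestronglyMeasurable g
  refine (lintegral_enorm_le_eLpNorm_two hf).trans (mul_le_mul_left ?_ _)
  have h := eLpNorm_add_le (hf.sub hg) hg (p := 2) (by norm_num)
  rw [sub_add_cancel] at h
  rw [Lp.enorm_def] at hN
  exact h.trans (add_le_add le_rfl hN)

theorem norm_fst_le_H1 {O : Set (Pt d)} (u : H1 O) : ‖u.1.fst‖ ≤ ‖u‖ := by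
  have := WithLp.prod_norm_sq_eq_of_L2 u.1
  exact (abs_le_of_sq_le_sq' (by rw [Submodule.coe_norm]; nlinarith [sq_nonneg ‖u.1.snd‖])
    (norm_nonneg _)).2

theorem norm_snd_le_H1 {O : Set (Pt d)} (u : H1 O) : ‖u.1.snd‖ ≤ ‖u‖ := by
  have := WithLp.prod_norm_sq_eq_of_L2 u.1
  exact (abs_le_of_sq_le_sq' (by rw [Submodule.coe_norm]; nlinarith [sq_nonneg ‖u.1.fst‖])
    (norm_nonneg _)).2

set_option maxHeartbeats 1000000 in
/-- Continuity of the trace from `H¹(O)` to `L¹(∂O)`. -/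
theorem IsPolyhedralLipschitzDomain.exists_trace_bound {O : Set (Pt d)}
    (hO : IsPolyhedralLipschitzDomain O) :
    ∃ C : NNReal, ∀ (u : H1 O) (γ : Lp ℝ 2 (surf (frontier O))), IsTrace O u γ →
      ∫⁻ x, ‖γ x‖ₑ ∂(surf (frontier O)) ≤ C * ‖u‖ₑ := by
  obtain ⟨C, hC⟩ := hO.hasTraceBound
  have := hO.isFiniteMeasure_surf
  have hvol : IsFiniteMeasure ((volume : Measure (Pt d)).restrict O) :=
    isFiniteMeasure_restrict.2 hO.isBounded.measure_lt_top.ne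
  -- `b` and `s` are the factors that Cauchy–Schwarz produces when passing from `L²` to `L¹` on `O`
  -- and on its boundary.
  obtain ⟨b, hb⟩ : ∃ b, b = (volume.restrict O) (univ : Set (Pt d)) ^ (2⁻¹ : ℝ) := ⟨_, rfl⟩
  obtain ⟨s, hs⟩ : ∃ s, s = (surf (frontier O)) univ ^ (2⁻¹ : ℝ) := ⟨_, rfl⟩
  have hbt : b ≠ ⊤ :=
    hb ▸ (ENNReal.rpow_lt_top_of_nonneg (by norm_num) (measure_ne_top _ _)).ne
  have hst : s ≠ ⊤ :=
    hs ▸ (ENNReal.rpow_lt_top_of_nonneg (by norm_num) (measure_ne_top _ _)).ne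
  lift b to NNReal using hbt
  refine ⟨C * (b * 2), fun u γ hγ => ?_⟩
  obtain ⟨φ, hφ, h1, h2, h3⟩ := hγ
  -- The trace inequality for the smooth approximants is taken to the limit. Both `u` and its
  -- gradient are bounded by `‖u‖`, which explains the factor `2` in the constant.
  have hlim : Tendsto (fun k => eLpNorm (fun x => φ k x - γ x) 2 (surf (frontier O)) * s +
      C * ((eLpNorm (fun x => φ k x - u.1.fst x) 2 (volume.restrict O) + ‖u‖ₑ) * b +
        (eLpNorm (fun x => ∇ (φ k) x - u.1.snd x) 2 (volume.restrict O) + ‖u‖ₑ) * b)) atTop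
      (𝓝 (0 * s + C * ((0 + ‖u‖ₑ) * b + (0 + ‖u‖ₑ) * b))) := by
    refine (ENNReal.Tendsto.mul_const h3 (Or.inr hst)).add (ENNReal.Tendsto.const_mul ?_
      (Or.inr ENNReal.coe_ne_top))
    exact (ENNReal.Tendsto.mul_const (h1.add_const _) (Or.inr ENNReal.coe_ne_top)).add
      (ENNReal.Tendsto.mul_const (h2.add_const _) (Or.inr ENNReal.coe_ne_top))
  have hle : ∫⁻ x, ‖γ x‖ₑ ∂(surf (frontier O)) ≤
      0 * s + C * ((0 + ‖u‖ₑ) * b + (0 + ‖u‖ₑ) * b) := by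
    refine ge_of_tendsto' hlim fun k => ?_
    have hgc := continuous_gradient' (hφ k)
    have hφc := (hφ k).continuous
    have hγm := Lp.aestronglyMeasurable γ
    have hA : ∫⁻ x, ‖φ k x - γ x‖ₑ ∂(surf (frontier O)) ≤
        eLpNorm (fun x => φ k x - γ x) 2 (surf (frontier O)) * s := by
      rw [hs]
      exact lintegral_enorm_le_eLpNorm_two (hφc.aestronglyMeasurable.sub hγm)
    have hB : ∫⁻ x in O, ‖φ k x‖ₑ ≤
        (eLpNorm (fun x => φ k x - u.1.fst x) 2 (volume.restrict O) + ‖u‖ₑ) * b := by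
      rw [hb]
      exact lintegral_enorm_le_of_approx hφc.aestronglyMeasurable _
        (enorm_le_iff_norm_le.2 (norm_fst_le_H1 u))
    have hD : ∫⁻ x in O, ‖∇ (φ k) x‖ₑ ≤
        (eLpNorm (fun x => ∇ (φ k) x - u.1.snd x) 2 (volume.restrict O) + ‖u‖ₑ) * b := by
      rw [hb]
      exact lintegral_enorm_le_of_approx hgc.aestronglyMeasurable _
        (enorm_le_iff_norm_le.2 (norm_snd_le_H1 u))
    have hE : ∫⁻ x in O, (‖φ k x‖ₑ + ‖∇ (φ k) x‖ₑ) =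
        (∫⁻ x in O, ‖φ k x‖ₑ) + ∫⁻ x in O, ‖∇ (φ k) x‖ₑ :=
      lintegral_add_left hφc.measurable.enorm _
    have hk : ∫⁻ x, ‖φ k x‖ₑ ∂(surf (frontier O)) ≤
        C * ((∫⁻ x in O, ‖φ k x‖ₑ) + ∫⁻ x in O, ‖∇ (φ k) x‖ₑ) := by
      rw [← hE]
      exact hC _ (hφ k)
    have hsum : ∫⁻ x, ‖γ x‖ₑ ∂(surf (frontier O)) ≤
        (∫⁻ x, ‖φ k x - γ x‖ₑ ∂(surf (frontier O))) + ∫⁻ x, ‖φ k x‖ₑ ∂(surf (frontier O)) := by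
      rw [← lintegral_add_right _ hφc.measurable.enorm]
      refine lintegral_mono fun x => ?_
      have := enorm_sub_le (E := ℝ) (a := φ k x) (b := φ k x - γ x)
      rw [sub_sub_cancel] at this
      rwa [add_comm]
    exact hsum.trans (add_le_add hA (hk.trans (mul_le_mul_right (add_le_add hB hD) _)))
  refine hle.trans (le_of_eq ?_)
  rw [zero_mul, zero_add, zero_add, ENNReal.coe_mul, ENNReal.coe_mul, ENNReal.coe_ofNat]
  ring

/-- Traces in `L²` are integrable because the surface measure is finite, and the normal is
measurable and bounded. -/
theorem integrable_normalComponent {O S : Set (Pt d)} (hO : IsPolyhedralLipschitzDomain O)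
    (hS : S ⊆ frontier O) (γ : Fin d → Lp ℝ 2 (surf (frontier O))) :
    Integrable (normalComponent O γ) (surf S) := by
  have := hO.isFiniteMeasure_surf
  refine Integrable.mono_measure (ν := surf (frontier O)) ?_ (Measure.restrict_mono hS le_rfl)
  refine integrable_finsetSum _ fun i _ => ?_
  refine (((Lp.memLp (γ i)).integrable (by norm_num)).mul_bdd (c := 1) ?_ ?_)
  · exact (EuclideanSpace.proj (𝕜 := ℝ) i).continuous.comp_aestronglyMeasurable
      (aestronglyMeasurable_outwardNormal O _)
  · exact Eventually.of_forall fun x =>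
      (PiLp.norm_apply_le (outwardNormal O x) i).trans (norm_outwardNormal_le O x)

/-- The flux through a part of the boundary is continuous in `H¹(O)^d`. -/
theorem IsPolyhedralLipschitzDomain.exists_flux_bound {O S : Set (Pt d)}
    (hO : IsPolyhedralLipschitzDomain O) (hS : S ⊆ frontier O) :
    ∃ C : NNReal, ∀ (u : H1Vec O) (γ : Fin d → Lp ℝ 2 (surf (frontier O))), IsVecTrace O u γ →
      |∫ x, normalComponent O γ x ∂(surf S)| ≤ C * ‖u‖ := by
  obtain ⟨C, hC⟩ := hO.exists_trace_bound
  -- One trace bound for each of the `d` components.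
  refine ⟨d * C, fun u γ hu => ?_⟩
  have h : ‖∫ x, normalComponent O γ x ∂(surf S)‖ₑ ≤ ((d * C : NNReal) : ℝ≥0∞) * ‖u‖ₑ := by
    calc ‖∫ x, normalComponent O γ x ∂(surf S)‖ₑ
        ≤ ∫⁻ x, ‖normalComponent O γ x‖ₑ ∂(surf S) := enorm_integral_le_lintegral_enorm _
      _ ≤ ∫⁻ x, ‖normalComponent O γ x‖ₑ ∂(surf (frontier O)) :=
          lintegral_mono' (Measure.restrict_mono hS le_rfl) le_rfl
      _ ≤ ∫⁻ x, ∑ i, ‖γ i x‖ₑ ∂(surf (frontier O)) := by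
          refine lintegral_mono fun x => (enorm_sum_le _ _).trans (Finset.sum_le_sum fun i _ => ?_)
          rw [enorm_mul]
          refine mul_le_of_le_one_right' ?_
          rw [← enorm_one (G := ℝ), enorm_le_iff_norm_le, norm_one]
          exact (PiLp.norm_apply_le (outwardNormal O x) i).trans (norm_outwardNormal_le O x)
      _ = ∑ i, ∫⁻ x, ‖γ i x‖ₑ ∂(surf (frontier O)) :=
          lintegral_finsetSum' _ fun i _ => (Lp.aestronglyMeasurable (γ i)).enorm
      _ ≤ ∑ i : Fin d, C * ‖u‖ₑ := by
          refine Finset.sum_le_sum fun i _ => (hC _ _ (hu i)).trans (mul_le_mul_right ?_ _)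
          exact enorm_le_iff_norm_le.2 (PiLp.norm_apply_le u i)
      _ = _ := by simp [mul_assoc]
  rw [← ofReal_norm, ← ofReal_norm, ← ENNReal.ofReal_coe_nnreal,
    ← ENNReal.ofReal_mul (NNReal.coe_nonneg _),
    ENNReal.ofReal_le_ofReal_iff (by positivity), Real.norm_eq_abs] at h
  exact h

/-! ### Smooth fields -/

theorem inner_gradient_eq_fderiv {f : Pt d → ℝ} (hf : ContDiff ℝ ∞ f) (x v : Pt d) :
    ⟪∇ f x, v⟫_ℝ = fderiv ℝ f x v := by
  have h := (hf.differentiable (by simp) x).hasGradientAt.hasFDerivAt.fderiv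
  rw [h]
  simp

theorem hasCompactSupport_gradient {f : Pt d → ℝ} (h : HasCompactSupport f) :
    HasCompactSupport (∇ f) :=
  (h.fderiv (𝕜 := ℝ)).comp_left (g := (InnerProductSpace.toDual ℝ (Pt d)).symm) (map_zero _)

theorem gradient_mul' {f g : Pt d → ℝ} (hf : ContDiff ℝ ∞ f) (hg : ContDiff ℝ ∞ g) (x : Pt d) :
    ∇ (fun y => f y * g y) x = f x • ∇ g x + g x • ∇ f x := by
  refine ext_inner_right ℝ fun v => ?_
  rw [inner_gradient_eq_fderiv (hf.mul hg), inner_add_left, real_inner_smul_left,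
    real_inner_smul_left, inner_gradient_eq_fderiv hf, inner_gradient_eq_fderiv hg,
    fderiv_fun_mul (hf.differentiable (by simp) x) (hg.differentiable (by simp) x)]
  simp

theorem support_gradient_subset_tsupport {f : Pt d → ℝ} : Function.support (∇ f) ⊆ tsupport f := by
  intro x hx
  refine support_fderiv_subset ℝ (fun h => hx ?_)
  rw [gradient, h, map_zero]

/-- Compact support of `g` alone makes the products integrable, so integration by parts has no
boundary term. -/
theorem integral_mul_inner_gradient {f g : Pt d → ℝ} (hf : ContDiff ℝ ∞ f) (hg : ContDiff ℝ ∞ g)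
    (hgc : HasCompactSupport g) (v : Pt d) :
    ∫ x, f x * ⟪∇ g x, v⟫_ℝ = -∫ x, ⟪∇ f x, v⟫_ℝ * g x := by
  have hgf := continuous_gradient' hf
  have hgg := continuous_gradient' hg
  have hfc := hf.continuous
  have hgc' := hg.continuous
  have h1 : Integrable fun x => ⟪∇ f x, v⟫_ℝ * g x :=
    Continuous.integrable_of_hasCompactSupport (by fun_prop) hgc.mul_left
  have h2 : Integrable fun x => f x * ⟪∇ g x, v⟫_ℝ :=
    Continuous.integrable_of_hasCompactSupport (by fun_prop)
      (((hasCompactSupport_gradient hgc).comp_left (g := fun z => ⟪z, v⟫_ℝ) (by simp)).mul_left)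
  have h3 : Integrable fun x => f x * g x :=
    Continuous.integrable_of_hasCompactSupport (by fun_prop) hgc.mul_left
  simp only [inner_gradient_eq_fderiv hf, inner_gradient_eq_fderiv hg] at h1 h2 ⊢
  exact integral_mul_fderiv_eq_neg_fderiv_mul_of_integrable h1 h2 h3
    (fun x _ => hf.differentiable (by simp) x) (fun x _ => hg.differentiable (by simp) x)

/-- The test function and its gradient vanish off `O`, so both integrals may be taken over the whole
space; no regularity of `O` enters. -/
theorem setIntegral_mul_inner_gradient {O : Set (Pt d)} {f φ : Pt d → ℝ} (hf : ContDiff ℝ ∞ f)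
    (hφ : IsTestFunction O φ) (v : Pt d) :
    ∫ x in O, f x * ⟪∇ φ x, v⟫_ℝ = -∫ x in O, ⟪∇ f x, v⟫_ℝ * φ x := by
  rw [setIntegral_eq_integral_of_forall_compl_eq_zero,
    setIntegral_eq_integral_of_forall_compl_eq_zero,
    integral_mul_inner_gradient hf hφ.1 hφ.2.1]
  · intro x hx
    rw [image_eq_zero_of_notMem_tsupport fun h => hx (hφ.2.2 h), mul_zero]
  · intro x hx
    rw [Function.notMem_support.1 fun h => hx (hφ.2.2 (support_gradient_subset_tsupport h)),
      inner_zero_left, mul_zero]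

theorem memLp_of_smooth {f : Pt d → ℝ} (hf : ContDiff ℝ ∞ f) (hc : HasCompactSupport f)
    (μ : Measure (Pt d)) [IsFiniteMeasureOnCompacts μ] : MemLp f 2 μ :=
  hf.continuous.memLp_of_hasCompactSupport hc

theorem memLp_gradient_of_smooth {f : Pt d → ℝ} (hf : ContDiff ℝ ∞ f) (hc : HasCompactSupport f)
    (μ : Measure (Pt d)) [IsFiniteMeasureOnCompacts μ] : MemLp (∇ f) 2 μ :=
  (continuous_gradient' hf).memLp_of_hasCompactSupport (hasCompactSupport_gradient hc)

/-- A smooth function with compact support as an element of `H¹(O)`. -/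
def smoothH1 (O : Set (Pt d)) (f : Pt d → ℝ) (hf : ContDiff ℝ ∞ f) (hc : HasCompactSupport f) :
    H1 O :=
  ⟨WithLp.toLp 2 ((memLp_of_smooth hf hc (volume.restrict O)).toLp f,
    (memLp_gradient_of_smooth hf hc (volume.restrict O)).toLp (∇ f)), by
    intro φ hφ
    refine ext_inner_right ℝ fun v => ?_
    rw [real_inner_comm, real_inner_comm v]
    have hm := memLp_of_smooth hf hc (volume.restrict O)
    have hg := memLp_gradient_of_smooth hf hc (volume.restrict O)
    rw [integral_congr_ae (g := fun x => f x • ∇ φ x) (by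
        filter_upwards [hm.coeFn_toLp] with x hx using congrArg (· • ∇ φ x) hx),
      integral_congr_ae (f := fun x => φ x • _) (g := fun x => φ x • ∇ f x) (by
        filter_upwards [hg.coeFn_toLp] with x hx using congrArg (φ x • ·) hx), inner_neg_right,
      ← integral_inner (integrable_smul_of_L2 hm (hφ.memLp_gradient _)),
      ← integral_inner (integrable_smul_of_L2 (hφ.memLp _) hg)]
    simp only [inner_smul_right]
    simpa only [real_inner_comm v, mul_comm] using setIntegral_mul_inner_gradient (O := O) hf hφ v⟩

theorem coeFn_smoothH1_fst (O : Set (Pt d)) {f : Pt d → ℝ} (hf : ContDiff ℝ ∞ f)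
    (hc : HasCompactSupport f) : (smoothH1 O f hf hc).1.fst =ᵐ[volume.restrict O] f :=
  (memLp_of_smooth hf hc (volume.restrict O)).coeFn_toLp

theorem coeFn_smoothH1_snd (O : Set (Pt d)) {f : Pt d → ℝ} (hf : ContDiff ℝ ∞ f)
    (hc : HasCompactSupport f) : (smoothH1 O f hf hc).1.snd =ᵐ[volume.restrict O] ∇ f :=
  (memLp_gradient_of_smooth hf hc (volume.restrict O)).coeFn_toLp

theorem eLpNorm_sub_eq_zero_of_ae {F : Type*} [NormedAddCommGroup F] {μ : Measure (Pt d)}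
    {f g : Pt d → F} (h : g =ᵐ[μ] f) : eLpNorm (fun x => f x - g x) 2 μ = 0 := by
  rw [eLpNorm_congr_ae (g := (0 : Pt d → F)), eLpNorm_zero]
  filter_upwards [h] with x hx
  rw [hx, sub_self, Pi.zero_apply]

theorem isTrace_smoothH1 {O : Set (Pt d)} [IsFiniteMeasureOnCompacts (surf (frontier O))]
    {f : Pt d → ℝ} (hf : ContDiff ℝ ∞ f) (hc : HasCompactSupport f) :
    IsTrace O (smoothH1 O f hf hc) ((memLp_of_smooth hf hc (surf (frontier O))).toLp f) := by
  refine ⟨fun _ => f, fun _ => hf, ?_, ?_, ?_⟩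
  · exact tendsto_const_nhds.congr fun _ =>
      (eLpNorm_sub_eq_zero_of_ae (coeFn_smoothH1_fst O hf hc)).symm
  · exact tendsto_const_nhds.congr fun _ =>
      (eLpNorm_sub_eq_zero_of_ae (coeFn_smoothH1_snd O hf hc)).symm
  · exact tendsto_const_nhds.congr fun _ =>
      (eLpNorm_sub_eq_zero_of_ae (memLp_of_smooth hf hc (surf (frontier O))).coeFn_toLp).symm

theorem memLp_smul_of_smooth {f : Pt d → ℝ} (hf : ContDiff ℝ ∞ f) (hc : HasCompactSupport f)
    (v : Pt d) (μ : Measure (Pt d)) [IsFiniteMeasureOnCompacts μ] :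
    MemLp (fun x => f x • v) 2 μ :=
  (hf.continuous.smul continuous_const).memLp_of_hasCompactSupport hc.smul_right

theorem memLp_inner_of_smooth {f : Pt d → ℝ} (hf : ContDiff ℝ ∞ f) (hc : HasCompactSupport f)
    (v : Pt d) (μ : Measure (Pt d)) [IsFiniteMeasureOnCompacts μ] :
    MemLp (fun x => ⟪∇ f x, v⟫_ℝ) 2 μ :=
  ((continuous_gradient' hf).inner continuous_const).memLp_of_hasCompactSupport
    ((hasCompactSupport_gradient hc).comp_left (g := fun z => ⟪z, v⟫_ℝ) (by simp))

/-- The field `f v` with a constant vector `v` as an element of `H(div, O)`. -/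
def smoothHdiv (O : Set (Pt d)) (f : Pt d → ℝ) (hf : ContDiff ℝ ∞ f) (hc : HasCompactSupport f)
    (v : Pt d) : Hdiv O :=
  ⟨WithLp.toLp 2 ((memLp_smul_of_smooth hf hc v (volume.restrict O)).toLp (fun x => f x • v),
    (memLp_inner_of_smooth hf hc v (volume.restrict O)).toLp (fun x => ⟪∇ f x, v⟫_ℝ)), by
    intro φ hφ
    rw [integral_congr_ae (g := fun x => f x * ⟪∇ φ x, v⟫_ℝ) (by
        filter_upwards [(memLp_smul_of_smooth hf hc v (volume.restrict O)).coeFn_toLp] with x hx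
        refine (congrArg (⟪·, ∇ φ x⟫_ℝ) hx).trans ?_
        rw [real_inner_smul_left, real_inner_comm]),
      integral_congr_ae (f := fun x => _ * φ x) (g := fun x => ⟪∇ f x, v⟫_ℝ * φ x) (by
        filter_upwards [(memLp_inner_of_smooth hf hc v (volume.restrict O)).coeFn_toLp] with x hx
        exact congrArg (· * φ x) hx)]
    exact setIntegral_mul_inner_gradient hf hφ v⟩

theorem coeFn_smoothHdiv_fst (O : Set (Pt d)) {f : Pt d → ℝ} (hf : ContDiff ℝ ∞ f)
    (hc : HasCompactSupport f) (v : Pt d) :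
    (smoothHdiv O f hf hc v).1.fst =ᵐ[volume.restrict O] fun x => f x • v :=
  (memLp_smul_of_smooth hf hc v (volume.restrict O)).coeFn_toLp

theorem coeFn_smoothHdiv_snd (O : Set (Pt d)) {f : Pt d → ℝ} (hf : ContDiff ℝ ∞ f)
    (hc : HasCompactSupport f) (v : Pt d) :
    (smoothHdiv O f hf hc v).1.snd =ᵐ[volume.restrict O] fun x => ⟪∇ f x, v⟫_ℝ :=
  (memLp_inner_of_smooth hf hc v (volume.restrict O)).coeFn_toLp

theorem normalPairing_smoothHdiv {O : Set (Pt d)} {f : Pt d → ℝ} (hf : ContDiff ℝ ∞ f)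
    (hc : HasCompactSupport f) (v : Pt d) (w : H1 O) :
    normalPairing (smoothHdiv O f hf hc v) w =
      (∫ x in O, ⟪f x • v, w.1.snd x⟫_ℝ) + ∫ x in O, ⟪⟪∇ f x, v⟫_ℝ, w.1.fst x⟫_ℝ := by
  rw [normalPairing, L2.inner_def, L2.inner_def]
  congr 1
  · refine integral_congr_ae ?_
    filter_upwards [coeFn_smoothHdiv_fst O hf hc v] with x hx
    rw [hx]
  · refine integral_congr_ae ?_
    filter_upwards [coeFn_smoothHdiv_snd O hf hc v] with x hx
    rw [hx]

/-- Cauchy–Schwarz. It transfers identities from smooth approximants to Sobolev functions and their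
traces. -/
theorem tendsto_integral_inner {F : Type*} [NormedAddCommGroup F] [InnerProductSpace ℝ F]
    {μ : Measure (Pt d)} {g f : Pt d → F} {a : ℕ → Pt d → F} (hg : MemLp g 2 μ) (hf : MemLp f 2 μ)
    (ha : ∀ k, AEStronglyMeasurable (a k) μ)
    (h : Tendsto (fun k => eLpNorm (fun x => a k x - f x) 2 μ) atTop (𝓝 0)) :
    Tendsto (fun k => ∫ x, ⟪g x, a k x⟫_ℝ ∂μ) atTop (𝓝 (∫ x, ⟪g x, f x⟫_ℝ ∂μ)) := by
  have hint : ∀ {b : Pt d → F}, MemLp b 2 μ → Integrable (fun x => ⟪g x, b x⟫_ℝ) μ := by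
    intro b hb
    refine (hg.norm.integrable_mul hb.norm).mono (hg.1.inner hb.1)
      (Eventually.of_forall fun x => ?_)
    simpa using abs_real_inner_le_norm (g x) (b x)
  refine tendsto_integral_of_L1 _ (hg.1.inner hf.1) ?_ ?_
  · filter_upwards [h.eventually (gt_mem_nhds ENNReal.zero_lt_top)] with k hk
    refine hint ?_
    have h1 : MemLp (fun x => a k x - f x) 2 μ := ⟨(ha k).sub hf.1, hk⟩
    exact (memLp_congr_ae (Eventually.of_forall fun x => by simp)).1 (h1.add hf)
  · have hb := ENNReal.Tendsto.const_mul (a := eLpNorm g 2 μ) h (Or.inr hg.2.ne)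
    rw [mul_zero] at hb
    refine tendsto_of_tendsto_of_tendsto_of_le_of_le tendsto_const_nhds hb (fun _ => zero_le)
      fun k => ?_
    have h1 := eLpNorm_le_eLpNorm_mul_eLpNorm_of_nnnorm (p := 2) (q := 2) (r := 1) hg.1
      ((ha k).sub hf.1) (fun u v => ⟪u, v⟫_ℝ) 1
      (Eventually.of_forall fun x => by rw [one_mul]; exact nnnorm_inner_le_nnnorm _ _)
    rw [eLpNorm_one_eq_lintegral_enorm, ENNReal.coe_one, one_mul] at h1
    refine le_trans (le_of_eq ?_) h1
    refine lintegral_congr fun x => ?_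
    rw [← inner_sub_right]
    rfl

/-- The divergence theorem on a half-space for fields with constant normal direction, up to the
normalization of the surface measure. -/
theorem exists_integral_halfSpace {n : Pt d} (hn : ‖n‖ = 1) (c : ℝ) :
    ∃ κ : ℝ, 0 < κ ∧ ∀ f : Pt d → ℝ, ContDiff ℝ ∞ f → HasCompactSupport f →
      κ * ∫ z in {z | c < ⟪n, z⟫_ℝ}, ⟪∇ f z, n⟫_ℝ =
        -∫ y in hyperplane n c, f y ∂(μHE[d - 1] : Measure (Pt d)) := by
  have hnn : ⟪n, n⟫_ℝ = 1 := by rw [real_inner_self_eq_norm_sq, hn]; norm_num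
  have hn0 : n ≠ 0 := by rintro rfl; simp at hn
  obtain ⟨κ, hκ0, hκ⟩ := exists_map_prod_hyperplane (n := n) (e := n) (by rw [hnn]; norm_num) c
  have := sigmaFinite_restrict_hyperplane hn0 c
  refine ⟨κ, by positivity, fun f hf hc => ?_⟩
  have hgc := continuous_gradient' hf
  have hm : MeasurableSet {z : Pt d | c < ⟪n, z⟫_ℝ} :=
    (isOpen_lt continuous_const (by fun_prop)).measurableSet
  set G : Pt d → ℝ := {z : Pt d | c < ⟪n, z⟫_ℝ}.indicator fun z => ⟪∇ f z, n⟫_ℝ with hG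
  have hGi : Integrable G := by
    refine (Continuous.integrable_of_hasCompactSupport (by fun_prop) ?_).indicator hm
    exact (hasCompactSupport_gradient hc).comp_left (g := fun z => ⟪z, n⟫_ℝ) (by simp)
  have hadd : Measurable fun q : Pt d × ℝ => q.1 + q.2 • n := by fun_prop
  have hGm : Integrable G ((((μHE[d - 1] : Measure (Pt d)).restrict (hyperplane n c)).prod
      volume).map fun q : Pt d × ℝ => q.1 + q.2 • n) := by
    rw [hκ]
    exact hGi.smul_measure_nnreal
  -- Starting on the hyperplane, the normal line lies in the half-space exactly for `t > 0`; the
  -- integral of the derivative leaves only the endpoint value.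
  have hline : ∀ y ∈ hyperplane n c, ∫ t : ℝ, G (y + t • n) = -f y := by
    intro y hy
    have hyc : ⟪n, y⟫_ℝ = c := hy
    have h1 : (fun t : ℝ => G (y + t • n)) =
        (Ioi (0 : ℝ)).indicator fun t => ⟪∇ f (y + t • n), n⟫_ℝ := by
      ext1 t
      simp only [hG, indicator_apply, mem_Ioi, mem_ofPred_eq, inner_add_right, hyc,
        inner_smul_right, hnn, mul_one, lt_add_iff_pos_right]
    have hemb : IsClosedEmbedding fun t : ℝ => y + t • n := by
      refine Isometry.isClosedEmbedding (Isometry.of_dist_eq fun s t => ?_)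
      rw [dist_add_left, dist_eq_norm, ← sub_smul, norm_smul, hn, mul_one, dist_eq_norm]
    have h2 := HasCompactSupport.integral_Ioi_deriv_eq (f := fun t : ℝ => f (y + t • n))
      ((hf.of_le (by simp)).comp (by fun_prop)) (hc.comp_isClosedEmbedding hemb) 0
    rw [h1, integral_indicator measurableSet_Ioi]
    simpa only [(hasDerivAt_comp_line hf y n _).deriv, zero_smul, add_zero] using h2
  calc κ * ∫ z in {z | c < ⟪n, z⟫_ℝ}, ⟪∇ f z, n⟫_ℝ
      = ∫ z, G z ∂(κ • (volume : Measure (Pt d))) := by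
        rw [integral_smul_nnreal_measure, hG, integral_indicator hm]
        rfl
    _ = ∫ q : Pt d × ℝ, G (q.1 + q.2 • n)
          ∂(((μHE[d - 1] : Measure (Pt d)).restrict (hyperplane n c)).prod volume) := by
        rw [← hκ, integral_map hadd.aemeasurable hGm.1]
    _ = ∫ y in hyperplane n c, (∫ t : ℝ, G (y + t • n)) ∂(μHE[d - 1] : Measure (Pt d)) :=
        integral_prod _ ((integrable_map_measure hGm.1 hadd.aemeasurable).1 hGm)
    _ = ∫ y in hyperplane n c, -f y ∂(μHE[d - 1] : Measure (Pt d)) :=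
        setIntegral_congr_fun (isClosed_hyperplane n c).measurableSet hline
    _ = _ := integral_neg _

/-! ### Fields supported near a flat piece of the interface -/

/-- Near `x` the interface is flat, with the unit normal `n` pointing from `ΩS` to `ΩD`. -/
structure IsFlatInterface (ΩS ΩD : Set (Pt d)) (x n : Pt d) (r : ℝ) : Prop where
  norm_eq : ‖n‖ = 1
  pos : 0 < r
  mem_S : ∀ y ∈ Metric.ball x r, y ∈ ΩS ↔ ⟪n, y - x⟫_ℝ < 0
  mem_D : ∀ y ∈ Metric.ball x r, y ∈ ΩD ↔ 0 < ⟪n, y - x⟫_ℝ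

variable {ΩS ΩD : Set (Pt d)} {x n : Pt d} {r : ℝ}

theorem IsFlatInterface.mem_frontier_S (h : IsFlatInterface ΩS ΩD x n r) {y : Pt d}
    (hy : y ∈ Metric.ball x r) : y ∈ frontier ΩS ↔ ⟪n, y - x⟫_ℝ = 0 :=
  mem_frontier_iff_flat h.norm_eq h.mem_S hy

theorem IsFlatInterface.mem_frontier_D (h : IsFlatInterface ΩS ΩD x n r) {y : Pt d}
    (hy : y ∈ Metric.ball x r) : y ∈ frontier ΩD ↔ ⟪n, y - x⟫_ℝ = 0 := by
  rw [mem_frontier_iff_flat (n := -n) (by rw [norm_neg, h.norm_eq])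
    (fun z hz => by rw [h.mem_D z hz, inner_neg_left, neg_lt_zero]) hy, inner_neg_left, neg_eq_zero]

theorem IsFlatInterface.mem_interface (h : IsFlatInterface ΩS ΩD x n r) {y : Pt d}
    (hy : y ∈ Metric.ball x r) : y ∈ interface ΩS ΩD ↔ ⟪n, y - x⟫_ℝ = 0 := by
  rw [interface, mem_inter_iff, h.mem_frontier_S hy, h.mem_frontier_D hy, and_self]

theorem IsFlatInterface.outwardNormal_eq (h : IsFlatInterface ΩS ΩD x n r) {y : Pt d}
    (hy : y ∈ Metric.ball x r) (hyI : y ∈ interface ΩS ΩD) : outwardNormal ΩS y = n :=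
  (isOutwardNormal_of_mem_ball h.norm_eq h.mem_S hy ((h.mem_interface hy).1 hyI)).outwardNormal_eq

theorem measurableSet_interface (ΩS ΩD : Set (Pt d)) : MeasurableSet (interface ΩS ΩD) :=
  (isClosed_frontier.inter isClosed_frontier).measurableSet

/-- Within the ball the interface and the hyperplane coincide, and outside it the integrand
vanishes. -/
theorem IsFlatInterface.integral_interface_eq (h : IsFlatInterface ΩS ΩD x n r) {g : Pt d → ℝ}
    (hg : ∀ y, y ∉ Metric.ball x r → g y = 0) :
    ∫ y, g y ∂(surf (interface ΩS ΩD)) =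
      ∫ y in hyperplane n ⟪n, x⟫_ℝ, g y ∂(μHE[d - 1] : Measure (Pt d)) := by
  have heq : (interface ΩS ΩD) ∩ Metric.ball x r = hyperplane n ⟪n, x⟫_ℝ ∩ Metric.ball x r := by
    ext y
    refine and_congr_left fun hy => ?_
    rw [h.mem_interface hy, inner_sub_right, sub_eq_zero]
    rfl
  have hres : ∀ S : Set (Pt d), MeasurableSet S →
      ∫ y in S, g y ∂(μHE[d - 1] : Measure (Pt d)) =
        ∫ y in S ∩ Metric.ball x r, g y ∂(μHE[d - 1] : Measure (Pt d)) := fun S hS =>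
    setIntegral_eq_of_subset_of_forall_sdiff_eq_zero hS inter_subset_left
      fun y hy => hg y fun hb => hy.2 ⟨hy.1, hb⟩
  rw [surf, hres _ (measurableSet_interface ΩS ΩD), heq,
    ← hres _ (isClosed_hyperplane n _).measurableSet]

theorem surf_interface_le (ΩS ΩD : Set (Pt d)) :
    surf (interface ΩS ΩD) ≤ surf (frontier ΩD) :=
  Measure.restrict_mono inter_subset_right le_rfl

theorem surf_interface_le_S (ΩS ΩD : Set (Pt d)) :
    surf (interface ΩS ΩD) ≤ surf (frontier ΩS) :=
  Measure.restrict_mono inter_subset_left le_rfl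

/-- The normal trace of `ψ n` on the interface. -/
theorem IsFlatInterface.exists_normalPairing_eq (h : IsFlatInterface ΩS ΩD x n r)
    (hD : IsOpen ΩD) (hfin : IsFiniteMeasure (surf (frontier ΩD))) :
    ∃ κ : ℝ, 0 < κ ∧ ∀ (ψ : Pt d → ℝ) (hψ : ContDiff ℝ ∞ ψ) (hψc : HasCompactSupport ψ),
      tsupport ψ ⊆ Metric.ball x r → ∀ w γ, IsTrace ΩD w γ →
        κ * normalPairing (smoothHdiv ΩD ψ hψ hψc n) w =
          -∫ y, ψ y * γ y ∂(surf (interface ΩS ΩD)) := by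
  obtain ⟨κ, hκ, hdiv⟩ := exists_integral_halfSpace h.norm_eq ⟪n, x⟫_ℝ
  refine ⟨κ, hκ, fun ψ hψ hψc hψB w γ hγ => ?_⟩
  obtain ⟨φ, hφ, h1, h2, h3⟩ := hγ
  have hle := surf_interface_le ΩS ΩD
  have : IsFiniteMeasure (surf (interface ΩS ΩD)) := isFiniteMeasure_of_le _ hle
  -- Both sides are continuous along the approximants of `w`, so it is enough to prove the identity
  -- for each smooth `φ k`. There the product rule turns the pairing into the integral of the normal
  -- derivative of `ψ * φ k`, whose support is compact thanks to `ψ`.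
  have hL : Tendsto (fun k => κ * ((∫ y in ΩD, ⟪ψ y • n, ∇ (φ k) y⟫_ℝ) +
      ∫ y in ΩD, ⟪⟪∇ ψ y, n⟫_ℝ, φ k y⟫_ℝ)) atTop
      (𝓝 (κ * normalPairing (smoothHdiv ΩD ψ hψ hψc n) w)) := by
    rw [normalPairing_smoothHdiv]
    exact ((tendsto_integral_inner (memLp_smul_of_smooth hψ hψc n _) (Lp.memLp _)
      (fun k => (continuous_gradient' (hφ k)).aestronglyMeasurable) h2).add
      (tendsto_integral_inner (memLp_inner_of_smooth hψ hψc n _) (Lp.memLp _)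
      (fun k => (hφ k).continuous.aestronglyMeasurable) h1)).const_mul κ
  have hR : Tendsto (fun k => -∫ y, ⟪ψ y, φ k y⟫_ℝ ∂(surf (interface ΩS ΩD))) atTop
      (𝓝 (-∫ y, ⟪ψ y, γ y⟫_ℝ ∂(surf (interface ΩS ΩD)))) := by
    refine (tendsto_integral_inner (memLp_of_smooth hψ hψc _) ((Lp.memLp γ).mono_measure hle)
      (fun k => (hφ k).continuous.aestronglyMeasurable) ?_).neg
    exact tendsto_of_tendsto_of_tendsto_of_le_of_le tendsto_const_nhds h3 (fun _ => zero_le)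
      fun k => eLpNorm_mono_measure _ hle
  have hmul : ∀ a b : ℝ, ⟪a, b⟫_ℝ = a * b := fun a b => by simp [mul_comm]
  simp only [hmul] at hR
  refine tendsto_nhds_unique (hL.congr fun k => ?_) hR
  have hf : ContDiff ℝ ∞ (fun y => ψ y * φ k y) := hψ.mul (hφ k)
  have hfc : HasCompactSupport (fun y => ψ y * φ k y) := hψc.mul_right
  have hzero : ∀ y, y ∉ Metric.ball x r → ψ y * φ k y = 0 := fun y hy => by
    rw [image_eq_zero_of_notMem_tsupport fun hm => hy (hψB hm), zero_mul]
  have hgrad : ∀ y, y ∉ Metric.ball x r → ⟪∇ (fun y => ψ y * φ k y) y, n⟫_ℝ = 0 := fun y hy => by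
    rw [Function.notMem_support.1 fun hm => hy (hψB (closure_mono
      (Function.support_mul_subset_left _ _) (support_gradient_subset_tsupport hm))),
      inner_zero_left]
  rw [h.integral_interface_eq hzero, ← hdiv _ hf hfc]
  congr 1
  have hgk := continuous_gradient' (hφ k)
  have hφk := (hφ k).continuous
  have hgψ := continuous_gradient' hψ
  have hψ' := hψ.continuous
  have hi1 : Integrable (fun y => ⟪ψ y • n, ∇ (φ k) y⟫_ℝ) (volume.restrict ΩD) :=
    (Continuous.integrable_of_hasCompactSupport (by fun_prop) (by
      simp only [real_inner_smul_left]
      exact hψc.mul_right)).restrict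
  have hi2 : Integrable (fun y => ⟪⟪∇ ψ y, n⟫_ℝ, φ k y⟫_ℝ) (volume.restrict ΩD) := by
    simp only [hmul]
    exact (Continuous.integrable_of_hasCompactSupport (by fun_prop)
      (((hasCompactSupport_gradient hψc).comp_left (g := fun z => ⟪z, n⟫_ℝ)
        (by simp)).mul_right)).restrict
  have hsum : (∫ y in ΩD, ⟪ψ y • n, ∇ (φ k) y⟫_ℝ) + ∫ y in ΩD, ⟪⟪∇ ψ y, n⟫_ℝ, φ k y⟫_ℝ =
      ∫ y in ΩD, ⟪∇ (fun y => ψ y * φ k y) y, n⟫_ℝ := by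
    rw [← integral_add hi1 hi2]
    refine integral_congr_ae (Eventually.of_forall fun y => ?_)
    simp only [gradient_mul' hψ (hφ k), inner_add_left, real_inner_smul_left, hmul]
    rw [real_inner_comm n (∇ ψ y), real_inner_comm n (∇ (φ k) y)]
    ring
  -- On the support of `ψ` the domain `ΩD` is the half-space, so the two indicator functions agree.
  rw [hsum, ← integral_indicator hD.measurableSet,
    ← integral_indicator (isOpen_lt continuous_const (by fun_prop)).measurableSet]
  congr 1
  ext1 y
  by_cases hy : y ∈ Metric.ball x r
  · have hiff : y ∈ ΩD ↔ y ∈ {z | ⟪n, x⟫_ℝ < ⟪n, z⟫_ℝ} := by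
      rw [h.mem_D y hy, inner_sub_right, sub_pos]
      rfl
    by_cases hyD : y ∈ ΩD
    · rw [indicator_of_mem hyD, indicator_of_mem (hiff.1 hyD)]
    · rw [indicator_of_notMem hyD, indicator_of_notMem (hiff.not.1 hyD)]
  · classical rw [indicator_apply, indicator_apply, hgrad y hy, ite_self, ite_self]

/-- The support of `ψ` cuts the interface in a relatively open piece of the hyperplane containing
`x`, which has positive measure. -/
theorem IsFlatInterface.integral_pos (h : IsFlatInterface ΩS ΩD x n r)
    (hfin : IsFiniteMeasure (surf (interface ΩS ΩD))) {ψ : Pt d → ℝ} (hψ : ContDiff ℝ ∞ ψ)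
    (hψc : HasCompactSupport ψ) (hψB : tsupport ψ ⊆ Metric.ball x r) (h0 : ∀ y, 0 ≤ ψ y)
    (hx : 0 < ψ x) : 0 < ∫ y, ψ y ∂(surf (interface ΩS ΩD)) := by
  have hn0 : n ≠ 0 := fun h0 => by simpa [h0] using h.norm_eq
  have hsupp : IsOpen (Function.support ψ) := hψ.continuous.isOpen_support
  rw [integral_pos_iff_support_of_nonneg h0
    (hψ.continuous.integrable_of_hasCompactSupport hψc)]
  have heq : Function.support ψ ∩ interface ΩS ΩD =
      Function.support ψ ∩ hyperplane n ⟪n, x⟫_ℝ := by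
    ext y
    refine and_congr_right fun hy => ?_
    rw [h.mem_interface (hψB (subset_tsupport ψ hy)), inner_sub_right, sub_eq_zero]
    rfl
  have hm : Continuous (fun w : ((ℝ ∙ n)ᗮ : Submodule ℝ (Pt d)) => x + (w : Pt d)) := by fun_prop
  rw [surf, Measure.restrict_apply hsupp.measurableSet, heq,
    ← Measure.restrict_apply hsupp.measurableSet, restrict_hyperplane hn0,
    Measure.map_apply hm.measurable hsupp.measurableSet]
  exact (hsupp.preimage hm).measure_pos _ ⟨0, by simpa using hx.ne'⟩

/-- Inside the ball all boundary points of `ΩS` belong to the interface, so `ψ` is zero on the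
exterior boundary. -/
theorem IsFlatInterface.vanishesOn (h : IsFlatInterface ΩS ΩD x n r) {ψ : Pt d → ℝ}
    (hψB : tsupport ψ ⊆ Metric.ball x r) {T : Lp ℝ 2 (surf (frontier ΩS))}
    (hT : T =ᵐ[surf (frontier ΩS)] ψ) : VanishesOn T (frontier ΩS \ interface ΩS ΩD) := by
  filter_upwards [hT] with y hy hyΓ
  rw [hy]
  by_contra hne
  have hyB : y ∈ Metric.ball x r := hψB (subset_tsupport ψ hne)
  exact hyΓ.2 ((h.mem_interface hyB).2 ((h.mem_frontier_S hyB).1 hyΓ.1))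

/-- Where `ψ` is nonzero on the interface the normal is `n`, and `n · n = 1`. -/
theorem IsFlatInterface.normalComponent_ae_eq (h : IsFlatInterface ΩS ΩD x n r) {ψ : Pt d → ℝ}
    (hψB : tsupport ψ ⊆ Metric.ball x r) {T : Lp ℝ 2 (surf (frontier ΩS))}
    (hT : T =ᵐ[surf (frontier ΩS)] ψ) :
    normalComponent ΩS (fun i => n i • T) =ᵐ[surf (interface ΩS ΩD)] ψ := by
  have hall : ∀ᵐ y ∂(surf (interface ΩS ΩD)), ∀ i,
      (n i • T : Lp ℝ 2 (surf (frontier ΩS))) y = n i * ψ y := by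
    refine ae_all_iff.2 fun i => (surf_interface_le_S ΩS ΩD).absolutelyContinuous.ae_le ?_
    filter_upwards [Lp.coeFn_smul (n i) T, hT] with y h1 h2
    rw [h1, Pi.smul_apply, h2, smul_eq_mul]
  filter_upwards [hall, ae_restrict_mem (measurableSet_interface ΩS ΩD)] with y h1 hyI
  rw [normalComponent]
  simp only [h1]
  by_cases hy : ψ y = 0
  · simp [hy]
  · rw [h.outwardNormal_eq (hψB (subset_tsupport ψ hy)) hyI]
    have hnn : ∑ i, n i * n i = 1 := by
      have := EuclideanSpace.real_norm_sq_eq n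
      rw [h.norm_eq] at this
      simpa [sq] using this.symm
    calc ∑ i, n i * ψ y * n i = (∑ i, n i * n i) * ψ y := by
          rw [Finset.sum_mul]
          exact Finset.sum_congr rfl fun i _ => by ring
      _ = ψ y := by rw [hnn, one_mul]

/-- A field in `H(div, ΩD)` whose normal trace is supported on the interface. -/
theorem mem_HD_of_normalPairing_eq {u : Hdiv ΩD} {ψ : Pt d → ℝ}
    (hu : ∀ w γ, IsTrace ΩD w γ →
      normalPairing u w = -∫ y, ψ y * γ y ∂(surf (interface ΩS ΩD))) : u ∈ HD ΩS ΩD := by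
  intro w δ hδ hv
  rw [hu w δ hδ, neg_eq_zero]
  refine integral_eq_zero_of_ae ?_
  filter_upwards [(surf_interface_le ΩS ΩD).absolutelyContinuous.ae_le hv,
    ae_restrict_mem (measurableSet_interface ΩS ΩD)] with y h1 h2
  rw [h1 h2, mul_zero, Pi.zero_apply]

/-- There is a velocity field with positive flux through the interface. -/
theorem IsStokesDarcyGeometry.exists_positive_flux {Ω : Set (Pt d)}
    (hΩ : IsStokesDarcyGeometry Ω ΩS ΩD) :
    ∃ u ∈ VelocitySpace ΩS ΩD, ∃ γ, IsVecTrace ΩS u.1 γ ∧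
      0 < ∫ y, normalComponent ΩS γ y ∂(surf (interface ΩS ΩD)) := by
  obtain ⟨x, n, r, hn, hr, hflat⟩ := hΩ.exists_flat
  have h : IsFlatInterface ΩS ΩD x n r :=
    ⟨hn, hr, fun y hy => (hflat y hy).1, fun y hy => (hflat y hy).2⟩
  have hfS := hΩ.domain_S.isFiniteMeasure_surf
  have hfD := hΩ.domain_D.isFiniteMeasure_surf
  have hfI : IsFiniteMeasure (surf (interface ΩS ΩD)) :=
    isFiniteMeasure_of_le _ (surf_interface_le ΩS ΩD)
  obtain ⟨ψ, hψ, hψc, hψB, hψ0, hψx⟩ : ∃ ψ : Pt d → ℝ, ContDiff ℝ ∞ ψ ∧ HasCompactSupport ψ ∧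
      tsupport ψ ⊆ Metric.ball x r ∧ (∀ y, 0 ≤ ψ y) ∧ 0 < ψ x := by
    let ψ : ContDiffBump x := ⟨r / 4, r / 2, by positivity, by linarith⟩
    refine ⟨ψ, ψ.contDiff, ψ.hasCompactSupport, ?_, fun y => ψ.nonneg,
      ψ.pos_of_mem_ball (Metric.mem_ball_self ψ.rOut_pos)⟩
    rw [ψ.tsupport_eq]
    exact Metric.closedBall_subset_ball (half_lt_self hr)
  -- Scaling the Darcy field by `κ` gives it the normal trace `ψ`, matching the Stokes field `ψ n`.
  obtain ⟨κ, -, hκ⟩ := h.exists_normalPairing_eq hΩ.domain_D.isOpen hfD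
  have hTψ := (memLp_of_smooth hψ hψc (surf (frontier ΩS))).coeFn_toLp
  have hnc := h.normalComponent_ae_eq hψB hTψ
  have htr : IsVecTrace ΩS (WithLp.toLp 2 fun i => n i • smoothH1 ΩS ψ hψ hψc)
      (fun i => n i • (memLp_of_smooth hψ hψc (surf (frontier ΩS))).toLp ψ) :=
    fun i => (isTrace_smoothH1 (O := ΩS) hψ hψc).smul (n i)
  have hpair : ∀ w δ, IsTrace ΩD w δ → normalPairing (κ • smoothHdiv ΩD ψ hψ hψc n) w =
      -∫ y, ψ y * δ y ∂(surf (interface ΩS ΩD)) := fun w δ hδ => by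
    rw [normalPairing_smul, hκ ψ hψ hψc hψB w δ hδ]
  refine ⟨(_, κ • smoothHdiv ΩD ψ hψ hψc n), ⟨⟨_, htr, fun i => (h.vanishesOn hψB hTψ).smul (n i)⟩,
    mem_HD_of_normalPairing_eq hpair, _, htr, fun w δ hδ _ => ?_⟩, _, htr, ?_⟩
  · rw [hpair w δ hδ]
    congr 1
    refine integral_congr_ae ?_
    filter_upwards [hnc] with y hy
    rw [hy]
  · rw [integral_congr_ae hnc]
    exact h.integral_pos hfI hψ hψc hψB hψ0 hψx

/-! ### Fluxes of differences and the approximation argument -/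

theorem IsVecTrace.sub {O : Set (Pt d)} {u v : H1Vec O}
    {γ δ : Fin d → Lp ℝ 2 (surf (frontier O))} (hu : IsVecTrace O u γ) (hv : IsVecTrace O v δ) :
    IsVecTrace O (u - v) (fun i => γ i - δ i) := by
  intro i
  have h := (hu i).add ((hv i).smul (-1))
  rwa [neg_one_smul, neg_one_smul, ← sub_eq_add_neg, ← sub_eq_add_neg] at h

theorem normalComponent_sub {O : Set (Pt d)} (γ δ : Fin d → Lp ℝ 2 (surf (frontier O))) :
    normalComponent O (fun i => γ i - δ i) =ᵐ[surf (frontier O)]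
      fun x => normalComponent O γ x - normalComponent O δ x := by
  have hall : ∀ᵐ y ∂(surf (frontier O)), ∀ i, (γ i - δ i : Lp ℝ 2 (surf (frontier O))) y =
      γ i y - δ i y := ae_all_iff.2 fun i => Lp.coeFn_sub _ _
  filter_upwards [hall] with y hy
  simp only [normalComponent, hy, sub_mul, Finset.sum_sub_distrib]

end StokesDarcy

end

open StokesDarcy
theorem mainTheorem9 (d : ℕ) (hd : d = 2 ∨ d = 3)
    (Ω ΩS ΩD : Set (EuclideanSpace ℝ (Fin d))) (hΩ : IsStokesDarcyGeometry Ω ΩS ΩD)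
    (H : Set ℝ) (hH : ∀ h ∈ H, 0 < h)
    (TS TD : ℝ → SimplicialComplex ℝ (EuclideanSpace ℝ (Fin d)))
    (hTS : ∀ h ∈ H, IsTriangulation ΩS h (TS h))
    (hTD : ∀ h ∈ H, IsTriangulation ΩD h (TD h))
    (VS : ℝ → Submodule ℝ (H1Vec ΩS)) (VD : ℝ → Submodule ℝ (Hdiv ΩD))
    (hVS : ∀ h ∈ H, IsStokesSpace (TS h) (VS h))
    (hVD : ∀ h ∈ H, IsDarcySpace (TD h) (VD h))
    (hΦ : ∀ h ∈ H, piecewiseConstant (interface ΩS ΩD) (TD h) ⊆ PhiD ΩS (VD h))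
    (hlift : HasStableLifting ΩS ΩD H VD)
    (happrox : ∀ u ∈ VelocitySpace ΩS ΩD,
      Tendsto (fun h => bestApproximationError (VS h) (VD h) u) (𝓝[H] 0) (𝓝 0)) :
    ∃ h₀ : ℝ, 0 < h₀ ∧ ∃ β₀ β₁ : ℝ, 0 < β₀ ∧ 0 < β₁ ∧
      ∀ h ∈ H, h ≤ h₀ → IsPermeable ΩD (VS h) β₀ β₁ := by
  obtain ⟨u, hu, γ, hγ, hI⟩ := hΩ.exists_positive_flux
  obtain ⟨C, hC⟩ := hΩ.domain_S.exists_flux_bound (S := interface ΩS ΩD) inter_subset_left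
  have hint := integrable_normalComponent hΩ.domain_S
    (S := interface ΩS ΩD) inter_subset_left
  set I := ∫ y, normalComponent ΩS γ y ∂(surf (interface ΩS ΩD)) with hIdef
  have hC0 : (0 : ℝ) ≤ C := C.2
  -- With this tolerance the flux changes by at most `C * I / (2 * (C + 1)) ≤ I / 2`; `C + 1` keeps
  -- the denominator positive when `C = 0`.
  have hε : 0 < I / (2 * (C + 1)) := by positivity
  obtain ⟨δ, hδ, hball⟩ := Metric.mem_nhdsWithin_iff.1
    ((happrox u hu).eventually (gt_mem_nhds hε))
  -- Halving `δ` turns the non-strict bound on `h` into membership in the open ball.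
  refine ⟨δ / 2, by positivity, I / 2, ‖u.1‖ + I / (2 * (C + 1)), by positivity, by positivity,
    fun h hh hhδ => ?_⟩
  have herr : bestApproximationError (VS h) (VD h) u < I / (2 * (C + 1)) := by
    refine hball ⟨?_, hh⟩
    rw [Metric.mem_ball, Real.dist_eq, sub_zero, abs_of_pos (hH h hh)]
    linarith
  -- The Darcy part of the error is nonnegative and can be dropped.
  have hinf : (⨅ v : ↥(VS h ⊓ H1S ΩS ΩD), ‖u.1 - v‖) < I / (2 * (C + 1)) :=
    lt_of_le_of_lt (le_add_of_nonneg_right (Real.iInf_nonneg fun v => norm_nonneg _)) herr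
  obtain ⟨⟨v, hv⟩, hvε⟩ := exists_lt_of_ciInf_lt hinf
  obtain ⟨γ', hγ', -⟩ := hv.2
  refine ⟨v, hv, γ', hγ', ?_, ?_⟩
  · have hflux := hC _ _ (hγ.sub hγ')
    rw [integral_congr_ae ((surf_interface_le_S ΩS ΩD).absolutelyContinuous.ae_le
        (normalComponent_sub γ γ')),
      integral_sub (hint γ) (hint γ')] at hflux
    have h1 := (abs_le.1 hflux).2
    have h2 : C * ‖u.1 - v‖ ≤ I / 2 := by
      calc C * ‖u.1 - v‖ ≤ (C + 1) * (I / (2 * (C + 1))) :=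
            mul_le_mul (by linarith) hvε.le (norm_nonneg _) (by positivity)
        _ = I / 2 := by field_simp
    linarith
  · have h1 := norm_sub_norm_le v u.1
    rw [norm_sub_rev] at h1
    linarith [hvε.le]
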